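/- **Proposition 4.1.** Let $n\ge 3$ and $M_1,M_2,A\ge 0$. There is a constant $C=C(n,M_1,M_2,A)<\infty$ with the following property. Let $I\subset\mathbb R$ be a (finite or infinite) interval with $0\in I$, and let $V:I\times\mathbb R^n\to\mathbb C$ be a measurable (in particular, possibly real-valued) time-dependent potential with $$\sup_{t\in I}\|V(t,\cdot)\|_{L^1\cap L^2}\le M_1,\qquad \sup_{t\in I}\|\hat V(t,\cdot)\|_{L^1}\le M_2,$$ where $\hat V(t,\xi)=\int_{\mathbb R^n} e^{-2\pi i x\cdot\xi}V(t,x)\,dx$ is the Fourier transform in $x$ only. Let $\psi_0\in L^1(\mathbb R^n)\cap L^2(\mathbb R^n)$ and let $\psi\in C(I;L^2(\mathbb R^n))$ be a solution, in the sense of (tempered) distributions, of the Schrödinger equation $$\frac1i\,\partial_t\psi-\frac{\Delta}{2}\psi+V(t,x)\psi=0,\qquad \psi|_{t=0}=\psi_0 .$$ Assume that $$\|\psi(t)\|_{L^2+L^\infty}\le A\,\langle t\rangle^{-n/2}\,\|\psi_0\|_{L^1\cap L^2}\qquad\text{for all }t\in I.$$ Then $$\|\psi(t)\|_{L^\infty}\le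 C\,|t|^{-n/2}\,\|\psi_0\|_{L^1\cap L^2}\qquad\text{for all }t\in I,\ t\ne 0.$$ Here $\langle t\rangle=(1+t^2)^{1/2}$, $\|f\|_{L^1\cap L^2}=\max(\|f\|_{L^1},\|f\|_{L^2})$ and $\|f\|_{L^2+L^\infty}=\inf_{f=h+g}(\|h\|_{L^2}+\|g\|_{L^\infty})$. The distributional equation is understood integrated in time: for every Schwartz function $\varphi$ and every $t\in I$, $$\frac1i\Big(\int\psi(t)\varphi\,dx-\int\psi_0\varphi\,dx\Big)-\frac12\int_0^t\!\!\int\psi(s)\,\Delta\varphi\,dx\,ds+\int_0^t\!\!\int V(s)\psi(s)\varphi\,dx\,ds=0 .$$ -/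

import Mathlib

open MeasureTheory
open scoped FourierTransform SchwartzMap Laplacian ENNReal NNReal

/-- Euclidean space of dimension `n`. -/
abbrev RSpace (n : ℕ) : Type := EuclideanSpace ℝ (Fin n)

/-- The norm of `L¹ ∩ L²`, with value `∞` for a function outside one of the two spaces. -/
noncomputable def normInter {n : ℕ} (f : RSpace n → ℂ) : ℝ≥0∞ :=
  max (eLpNorm f 1 volume) (eLpNorm f 2 volume)

/-- The norm of `L² + L^∞`: the infimum of `‖h‖_{L²} + ‖g‖_{L^∞}` over all decompositions
`f = h + g` (almost everywhere) with `h ∈ L²` and `g ∈ L^∞`. It is `∞` if there are none. -/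
noncomputable def normSum {n : ℕ} (f : RSpace n → ℂ) : ℝ≥0∞ :=
  ⨅ (h : RSpace n → ℂ) (g : RSpace n → ℂ) (_ : MemLp h 2 volume) (_ : MemLp g ∞ volume)
    (_ : f =ᵐ[volume] fun x => h x + g x), eLpNorm h 2 volume + eLpNorm g ∞ volume

/-- The bracket `⟨t⟩ = (1 + t²)^{1/2}`. -/
noncomputable def bracket (t : ℝ) : ℝ := Real.sqrt (1 + t ^ 2)

/-- `ψ ∈ C(I; L²)` is a solution of `(1/i) ∂ₜψ - (Δ/2) ψ + V(t,x) ψ = 0`, `ψ|_{t=0} = ψ₀`, on the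
time interval `I ∋ 0`: the equation, integrated in time from `0` to `t`, holds in the sense of
tempered distributions for every `t ∈ I`. -/
structure IsSchrodingerSolution {n : ℕ} (I : Set ℝ) (V : ℝ → RSpace n → ℂ)
    (ψ₀ : Lp ℂ 2 (volume : Measure (RSpace n))) (ψ : ℝ → Lp ℂ 2 (volume : Measure (RSpace n))) :
    Prop where
  continuousOn : ContinuousOn ψ I
  initial : ψ 0 = ψ₀
  integrable : ∀ φ : 𝓢(RSpace n, ℂ), ∀ t ∈ I,
    IntervalIntegrable (fun s => ∫ x, V s x * ψ s x * φ x) volume 0 t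
  equation : ∀ φ : 𝓢(RSpace n, ℂ), ∀ t ∈ I,
    (1 / Complex.I) * ((∫ x, ψ t x * φ x) - ∫ x, ψ₀ x * φ x)
      - (1 / 2) * (∫ s in (0 : ℝ)..t, ∫ x, ψ s x * (Δ φ) x)
      + (∫ s in (0 : ℝ)..t, ∫ x, V s x * ψ s x * φ x) = 0

/-! ### Complex Gaussians as Schwartz functions -/

/-! Fix `t` and pair `ψ(s)`, without conjugation, with a Gaussian wave packet `packet ε y ξ (t -
s)`, which evolves freely and becomes a modulated Gaussian at `s = t`. The Laplacian terms cancel,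
so this coefficient changes in `s` only through `-i ∫ V ψ φ`
(`IsSchrodingerSolution.norm_integral_packet_sub_le`). All bounds on the coefficients at `s = t`
must be uniform in `ε`; letting `ε → 0` with `ξ = 0` then bounds `ψ(t)` in `L^∞`
(`eLpNorm_top_le_of_forall_norm_integral_packet_le`).

Away from `s = t`, packets obey the dispersive bound `|t - s|^{-n/2}`, while Hölder and the assumed
decay bound `‖Vψ(s)‖_{L¹}` by a multiple of `⟨s⟩^{-n/2}`. Since `n/2 > 1`, the product of the two
weights over `|t - s| ≥ δ` integrates to `O(|t|^{-n/2})`. This controls all coefficients at a time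
`a` near `t` (`IsSchrodingerSolution.norm_integral_packet_le_of_decay`).

On the remaining interval, of length at most `δ`, the dispersive weight is not integrable. There `V`
is a superposition of characters with total mass at most `M₂`, and by Galilean invariance a
character times a packet is again a packet up to a phase (`exists_character_mul_packet`). Hence the
supremum `K` of the coefficients over all times in the interval and all `y`, `ξ` satisfies `K ≤ R +
M₂ δ K`, where `R` bounds them at time `a`. With `M₂ δ ≤ 1/2` this gives `K ≤ 2R`
(`IsSchrodingerSolution.norm_integral_packet_le_two_mul`). -/

theorem one_add_pow_mul_exp_neg_sq_le (m : ℕ) {κ : ℝ} (hκ : 0 < κ) :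
    ∃ C : ℝ, 0 ≤ C ∧ ∀ r : ℝ, 0 ≤ r → (1 + r) ^ m * Real.exp (-κ * r ^ 2) ≤ C := by
  refine ⟨m.factorial * Real.exp (1 + 1 / (4 * κ)), by positivity, fun r hr => ?_⟩
  have h1 : (1 + r) ^ m ≤ m.factorial * Real.exp (1 + r) := by
    have := Real.pow_div_factorial_le_exp (1 + r) (by positivity) m
    rwa [div_le_iff₀' (by positivity)] at this
  calc (1 + r) ^ m * Real.exp (-κ * r ^ 2)
      ≤ m.factorial * Real.exp (1 + r) * Real.exp (-κ * r ^ 2) := by gcongr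
    _ = m.factorial * Real.exp (1 + r + -κ * r ^ 2) := by rw [mul_assoc, ← Real.exp_add]
    _ ≤ m.factorial * Real.exp (1 + 1 / (4 * κ)) := by
      refine mul_le_mul_of_nonneg_left (Real.exp_le_exp.2 ?_) (by positivity)
      -- Completing the square gives `r - κ r² ≤ 1 / (4κ)`.
      have : 0 ≤ (2 * κ * r - 1) ^ 2 / (4 * κ) := by positivity
      have e : (2 * κ * r - 1) ^ 2 / (4 * κ) = κ * r ^ 2 - r + 1 / (4 * κ) := by
        field_simp; ring
      linarith

theorem norm_iteratedFDeriv_real_cexp (i : ℕ) (w : ℂ) :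
    ‖iteratedFDeriv ℝ i Complex.exp w‖ = ‖Complex.exp w‖ := by
  have h : ContDiffAt ℂ i Complex.exp w := Complex.contDiff_exp.contDiffAt
  rw [← h.restrictScalars_iteratedFDeriv (𝕜 := ℝ), Function.comp_apply,
    ContinuousMultilinearMap.norm_restrictScalars, norm_iteratedFDeriv_eq_norm_iteratedDeriv,
    iteratedDeriv_eq_iterate, Complex.iter_deriv_exp]

/-- Every derivative of `exp` has the norm of `exp` itself, so the Faà di Bruno bound for `exp ∘ f`
is `‖exp (f x)‖` times a polynomial in `‖x‖`, which the Gaussian bound absorbs. -/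
theorem exists_schwartzMap_cexp {E : Type*} [NormedAddCommGroup E] [NormedSpace ℝ E]
    {f : E → ℂ} (hf : f.HasTemperateGrowth) {C κ : ℝ} (hκ : 0 < κ)
    (hb : ∀ x, ‖Complex.exp (f x)‖ ≤ C * Real.exp (-κ * ‖x‖ ^ 2)) :
    ∃ φ : 𝓢(E, ℂ), ∀ x, φ x = Complex.exp (f x) := by
  refine ⟨⟨Complex.exp ∘ f, ?_, ?_⟩, fun x => rfl⟩
  · exact (Complex.contDiff_exp.comp hf.1)
  · intro k n
    obtain ⟨l, D, hD0, hD⟩ := hf.norm_iteratedFDeriv_le_uniform n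
    obtain ⟨K, hK0, hK⟩ := one_add_pow_mul_exp_neg_sq_le (k + l * n) hκ
    have hC : 0 ≤ C := by
      have := (norm_nonneg _).trans (hb 0)
      simpa using this
    refine ⟨n.factorial * C * (max D 1) ^ n * K, fun x => ?_⟩
    have hx1 : (1 : ℝ) ≤ 1 + ‖x‖ := by linarith [norm_nonneg x]
    have h1 : ‖iteratedFDeriv ℝ n (Complex.exp ∘ f) x‖
        ≤ n.factorial * ‖Complex.exp (f x)‖ * (max D 1 * (1 + ‖x‖) ^ l) ^ n := by
      refine norm_iteratedFDeriv_comp_le (N := (n : ℕ∞)) (Complex.contDiff_exp)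
        (hf.1.of_le (by exact_mod_cast le_top)) le_rfl x
        (fun i _ => (norm_iteratedFDeriv_real_cexp i _).le) (fun i hi hin => ?_)
      refine (hD i hin x).trans ?_
      -- The maximum with 1 makes the base at least 1, so that its first power is below its `i`-th
      -- power, the form the composition bound needs.
      have h2 : (1 : ℝ) ≤ max D 1 * (1 + ‖x‖) ^ l :=
        one_le_mul_of_one_le_of_one_le (le_max_right _ _) (one_le_pow₀ hx1)
      refine le_trans ?_ (le_self_pow₀ h2 (by omega))
      gcongr
      exact le_max_left _ _
    calc ‖x‖ ^ k * ‖iteratedFDeriv ℝ n (Complex.exp ∘ f) x‖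
        ≤ (1 + ‖x‖) ^ k * (n.factorial * (C * Real.exp (-κ * ‖x‖ ^ 2)) *
            (max D 1 * (1 + ‖x‖) ^ l) ^ n) := by
          refine mul_le_mul ?_ (h1.trans ?_) (norm_nonneg _) (by positivity)
          · gcongr; linarith
          · gcongr; exact hb x
      _ = n.factorial * C * (max D 1) ^ n *
            ((1 + ‖x‖) ^ (k + l * n) * Real.exp (-κ * ‖x‖ ^ 2)) := by
          rw [pow_add, pow_mul, mul_pow]; ring
      _ ≤ _ := by gcongr; exact hK _ (norm_nonneg x)

/-- A lower bound for a translated square by a centred one. -/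
theorem half_norm_sq_sub_le {E : Type*} [NormedAddCommGroup E] (x a : E) :
    ‖x‖ ^ 2 / 2 - ‖a‖ ^ 2 ≤ ‖x - a‖ ^ 2 := by
  have h : ‖x‖ ≤ ‖x - a‖ + ‖a‖ := by simpa using norm_add_le (x - a) a
  nlinarith [norm_nonneg x, norm_nonneg a, norm_nonneg (x - a), sq_nonneg (‖x - a‖ - ‖a‖),
    mul_self_le_mul_self (norm_nonneg x) h]

theorem exists_schwartzMap_gaussian {n : ℕ} {β : ℂ} (hβ : 0 < β.re) (γ c : ℂ) (y ξ : RSpace n) :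
    ∃ φ : 𝓢(RSpace n, ℂ), ∀ x, φ x =
      c * Complex.exp (-β * (‖x - y‖ ^ 2 : ℝ) + γ * (inner ℝ (x - y) ξ : ℝ)) := by
  have hsub : (fun x : RSpace n => x - y).HasTemperateGrowth :=
    Function.HasTemperateGrowth.id'.sub (Function.HasTemperateGrowth.const y)
  have h1 : (fun x : RSpace n => ((‖x - y‖ ^ 2 : ℝ) : ℂ)).HasTemperateGrowth :=
    Function.Complex.hasTemperateGrowth_ofReal.comp
      ((Function.hasTemperateGrowth_norm_sq (H := RSpace n)).comp hsub)
  have h2 : (fun x : RSpace n => ((inner ℝ (x - y) ξ : ℝ) : ℂ)).HasTemperateGrowth :=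
    Function.Complex.hasTemperateGrowth_ofReal.comp
      ((Function.hasTemperateGrowth_inner_left ξ).comp hsub)
  have hf : (fun x : RSpace n =>
      -β * (‖x - y‖ ^ 2 : ℝ) + γ * (inner ℝ (x - y) ξ : ℝ)).HasTemperateGrowth :=
    ((Function.HasTemperateGrowth.const (-β)).mul h1).add
      ((Function.HasTemperateGrowth.const γ).mul h2)
  have hκ : 0 < β.re / 4 := by positivity
  obtain ⟨φ, hφ⟩ := exists_schwartzMap_cexp hf hκ
    (C := Real.exp (γ.re ^ 2 * ‖ξ‖ ^ 2 / (2 * β.re) + β.re / 2 * ‖y‖ ^ 2)) (fun x => by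
      rw [Complex.norm_exp, ← Real.exp_add]
      gcongr
      simp only [Complex.add_re, Complex.mul_re, Complex.neg_re, Complex.ofReal_re,
        Complex.ofReal_im, mul_zero, sub_zero]
      have h3 := half_norm_sq_sub_le x y
      have h4 : γ.re * inner ℝ (x - y) ξ ≤
          β.re / 2 * ‖x - y‖ ^ 2 + γ.re ^ 2 * ‖ξ‖ ^ 2 / (2 * β.re) := by
        have h5 : γ.re * inner ℝ (x - y) ξ ≤ |γ.re| * (‖x - y‖ * ‖ξ‖) := by
          refine (le_abs_self _).trans ?_
          rw [abs_mul]
          gcongr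
          exact abs_real_inner_le_norm _ _
        have h6 : 0 ≤ (β.re * ‖x - y‖ - |γ.re| * ‖ξ‖) ^ 2 / (2 * β.re) := by positivity
        have h7 : (β.re * ‖x - y‖ - |γ.re| * ‖ξ‖) ^ 2 / (2 * β.re) = β.re / 2 * ‖x - y‖ ^ 2
            + γ.re ^ 2 * ‖ξ‖ ^ 2 / (2 * β.re) - |γ.re| * (‖x - y‖ * ‖ξ‖) := by
          rw [← sq_abs γ.re]
          field_simp
          ring
        linarith
      nlinarith)
  exact ⟨c • φ, fun x => by simp [hφ]⟩

/-! ### Gaussian wave packets -/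

/-- The complex width `ε + iτ` of a free wave packet at time `τ`. -/
noncomputable def packetWidth (ε τ : ℝ) : ℂ := ε + τ * Complex.I

/-- The quadratic form in the exponent of a Gaussian wave packet. -/
noncomputable def packetForm {n : ℕ} (ε : ℝ) (y ξ x : RSpace n) : ℂ :=
  -((‖x - y‖ ^ 2 : ℝ) : ℂ) / 2 + 2 * Real.pi * Complex.I * ε * ((inner ℝ (x - y) ξ : ℝ) : ℂ)
    + 2 * Real.pi ^ 2 * ε ^ 2 * ((‖ξ‖ ^ 2 : ℝ) : ℂ)

/-- The free Schrödinger evolution at time `τ` of the Gaussian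
`ε ^ (-n / 2) * exp (-‖x - y‖² / (2ε) + 2πi⟪x - y, ξ⟫)`. -/
noncomputable def packet {n : ℕ} (ε : ℝ) (y ξ : RSpace n) (τ : ℝ) (x : RSpace n) : ℂ :=
  Complex.exp (-(2 * Real.pi ^ 2 * ε * ((‖ξ‖ ^ 2 : ℝ) : ℂ)))
    * packetWidth ε τ ^ (((-(n : ℝ) / 2 : ℝ)) : ℂ)
    * Complex.exp (packetForm ε y ξ x / packetWidth ε τ)

theorem packetWidth_re (ε τ : ℝ) : (packetWidth ε τ).re = ε := by simp [packetWidth]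

theorem packetWidth_im (ε τ : ℝ) : (packetWidth ε τ).im = τ := by simp [packetWidth]

theorem packetWidth_ne_zero {ε : ℝ} (hε : 0 < ε) (τ : ℝ) : packetWidth ε τ ≠ 0 := by
  intro h
  have := packetWidth_re ε τ
  rw [h] at this
  simp at this
  exact hε.ne this

theorem packetWidth_mem_slitPlane {ε : ℝ} (hε : 0 < ε) (τ : ℝ) :
    packetWidth ε τ ∈ Complex.slitPlane :=
  Or.inl (by rwa [packetWidth_re])

theorem normSq_packetWidth (ε τ : ℝ) : Complex.normSq (packetWidth ε τ) = ε ^ 2 + τ ^ 2 := by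
  rw [Complex.normSq_apply, packetWidth_re, packetWidth_im]; ring

theorem le_norm_packetWidth {ε : ℝ} (hε : 0 < ε) (τ : ℝ) : ε ≤ ‖packetWidth ε τ‖ := by
  have := Complex.abs_re_le_norm (packetWidth ε τ)
  rwa [packetWidth_re, abs_of_pos hε] at this

theorem abs_le_norm_packetWidth (ε τ : ℝ) : |τ| ≤ ‖packetWidth ε τ‖ := by
  have := Complex.abs_im_le_norm (packetWidth ε τ)
  rwa [packetWidth_im] at this

theorem hasDerivAt_packetWidth (ε τ : ℝ) : HasDerivAt (packetWidth ε) Complex.I τ := by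
  have := ((Complex.ofRealCLM.hasDerivAt (x := τ)).mul_const Complex.I).const_add (ε : ℂ)
  exact this.congr_deriv (by simp)

theorem exists_schwartzMap_packet {n : ℕ} {ε : ℝ} (hε : 0 < ε) (y ξ : RSpace n) (τ : ℝ) :
    ∃ φ : 𝓢(RSpace n, ℂ), ∀ x, φ x = packet ε y ξ τ x := by
  have hz := packetWidth_ne_zero hε τ
  have hβ : 0 < (1 / (2 * packetWidth ε τ)).re := by
    rw [one_div, Complex.inv_re]
    have : (2 * packetWidth ε τ).re = 2 * ε := by simp [packetWidth_re]
    rw [this]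
    have : 0 < Complex.normSq (2 * packetWidth ε τ) :=
      Complex.normSq_pos.2 (mul_ne_zero two_ne_zero hz)
    positivity
  obtain ⟨φ, hφ⟩ := exists_schwartzMap_gaussian hβ
    (2 * Real.pi * Complex.I * ε / packetWidth ε τ)
    (Complex.exp (-(2 * Real.pi ^ 2 * ε * ((‖ξ‖ ^ 2 : ℝ) : ℂ)))
      * packetWidth ε τ ^ (((-(n : ℝ) / 2 : ℝ)) : ℂ)
      * Complex.exp (2 * Real.pi ^ 2 * ε ^ 2 * ((‖ξ‖ ^ 2 : ℝ) : ℂ) / packetWidth ε τ)) y ξ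
  refine ⟨φ, fun x => ?_⟩
  rw [hφ, packet, packetForm, mul_assoc _ (Complex.exp _) (Complex.exp _), ← Complex.exp_add]
  congr 2
  field_simp
  ring

theorem norm_packet {n : ℕ} {ε : ℝ} (hε : 0 < ε) (y ξ : RSpace n) (τ : ℝ) (x : RSpace n) :
    ‖packet ε y ξ τ x‖ = ‖packetWidth ε τ‖ ^ (-(n : ℝ) / 2) *
      Real.exp (-(ε / (2 * (ε ^ 2 + τ ^ 2))) * ‖x - y - (2 * Real.pi * τ) • ξ‖ ^ 2) := by
  rw [packet, norm_mul, norm_mul, Complex.norm_cpow_real, mul_comm ‖Complex.exp _‖, mul_assoc,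
    Complex.norm_exp, Complex.norm_exp, ← Real.exp_add]
  congr 2
  have hN : ε ^ 2 + τ ^ 2 ≠ 0 := by positivity
  rw [Complex.div_re, normSq_packetWidth, packetWidth_re, packetWidth_im, norm_sub_sq_real,
    inner_smul_right, norm_smul, mul_pow, Real.norm_eq_abs, sq_abs]
  have h1 : (packetForm ε y ξ x).re = -‖x - y‖ ^ 2 / 2 + 2 * Real.pi ^ 2 * ε ^ 2 * ‖ξ‖ ^ 2 := by
    simp [packetForm, ← Complex.ofReal_pow]
  have h2 : (packetForm ε y ξ x).im = 2 * Real.pi * ε * inner ℝ (x - y) ξ := by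
    simp [packetForm, ← Complex.ofReal_pow]
  have h3 : (-(2 * Real.pi ^ 2 * ε * ((‖ξ‖ ^ 2 : ℝ) : ℂ))).re = -(2 * Real.pi ^ 2 * ε * ‖ξ‖ ^ 2) := by
    simp [← Complex.ofReal_pow]
  rw [h1, h2, h3]
  field_simp
  ring

/-- The dispersive estimate: the modulus of the width dominates `|τ|` and the Gaussian factor is at
most 1, so `ε`, `y` and `ξ` do not enter the bound. -/
theorem norm_packet_le {n : ℕ} {ε : ℝ} (hε : 0 < ε) (y ξ : RSpace n) {τ : ℝ} (hτ : τ ≠ 0)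
    (x : RSpace n) : ‖packet ε y ξ τ x‖ ≤ |τ| ^ (-(n : ℝ) / 2) := by
  rw [norm_packet hε]
  calc _ ≤ |τ| ^ (-(n : ℝ) / 2) * 1 := by
        refine mul_le_mul (Real.rpow_le_rpow_of_nonpos (abs_pos.2 hτ)
          (abs_le_norm_packetWidth ε τ) ?_) ?_ (Real.exp_nonneg _) (by positivity)
        · rw [neg_div]
          exact neg_nonpos.2 (by positivity)
        · rw [Real.exp_le_one_iff, neg_mul]
          exact neg_nonpos.2 (by positivity)
    _ = _ := mul_one _

/-- Multiplication by a character maps wave packets to wave packets, up to a phase. -/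
theorem exists_character_mul_packet {n : ℕ} {ε : ℝ} (hε : 0 < ε) (y ξ ζ : RSpace n) (τ : ℝ) :
    ∃ ω : ℂ, ‖ω‖ = 1 ∧ ∀ x, Complex.exp ((2 * Real.pi * inner ℝ x ζ : ℝ) * Complex.I)
      * packet ε y ξ τ x = ω * packet ε (y - (2 * Real.pi * τ) • ζ) (ξ + ζ) τ x := by
  have hz := packetWidth_ne_zero hε τ
  -- Galilean invariance: the boost by `ζ` adds a drift `2πτζ`, which the shift of the initial
  -- centre undoes, so the packet at time `τ` stays centred at `y + 2πτξ`.
  refine ⟨Complex.exp ((2 * Real.pi * inner ℝ y ζ - 2 * Real.pi ^ 2 * τ * ‖ζ‖ ^ 2 : ℝ)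
    * Complex.I), Complex.norm_exp_ofReal_mul_I _, fun x => ?_⟩
  have hx : x - (y - (2 * Real.pi * τ) • ζ) = (x - y) + (2 * Real.pi * τ) • ζ := by abel
  have hxy : (inner ℝ x ζ : ℝ) = inner ℝ (x - y) ζ + inner ℝ y ζ := by
    rw [← inner_add_left, sub_add_cancel]
  have key : (2 * Real.pi * inner ℝ x ζ : ℝ) * Complex.I
      + (-(2 * Real.pi ^ 2 * ε * ((‖ξ‖ ^ 2 : ℝ) : ℂ)) + packetForm ε y ξ x / packetWidth ε τ)
      = (2 * Real.pi * inner ℝ y ζ - 2 * Real.pi ^ 2 * τ * ‖ζ‖ ^ 2 : ℝ) * Complex.I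
      + (-(2 * Real.pi ^ 2 * ε * ((‖ξ + ζ‖ ^ 2 : ℝ) : ℂ))
        + packetForm ε (y - (2 * Real.pi * τ) • ζ) (ξ + ζ) x / packetWidth ε τ) := by
    rw [packetForm, packetForm, hx, hxy, norm_add_sq_real (x - y), norm_add_sq_real ξ ζ,
      norm_smul, inner_add_left, inner_add_right, inner_add_right, inner_smul_left,
      inner_smul_left, inner_smul_right, mul_pow, Real.norm_eq_abs, sq_abs,
      real_inner_comm ξ ζ, real_inner_self_eq_norm_sq]
    generalize (inner ℝ (x - y) ζ : ℝ) = a1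
    generalize (inner ℝ (x - y) ξ : ℝ) = a2
    generalize (inner ℝ y ζ : ℝ) = a3
    generalize (inner ℝ ζ ξ : ℝ) = a4
    generalize ‖x - y‖ = b1
    generalize ‖ξ‖ = b2
    generalize ‖ζ‖ = b3
    simp only [conj_trivial]
    push_cast
    field_simp
    have hI : Complex.I ^ 2 = -1 := Complex.I_sq
    simp only [packetWidth]
    ring_nf
    simp only [hI]
    ring
  rw [packet, packet]
  calc _ = Complex.exp ((2 * Real.pi * inner ℝ x ζ : ℝ) * Complex.I
      + (-(2 * Real.pi ^ 2 * ε * ((‖ξ‖ ^ 2 : ℝ) : ℂ)) + packetForm ε y ξ x / packetWidth ε τ))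
        * packetWidth ε τ ^ (((-(n : ℝ) / 2 : ℝ)) : ℂ) := by
        rw [Complex.exp_add, Complex.exp_add]; ring
    _ = _ := by rw [key, Complex.exp_add, Complex.exp_add]; ring

/-- The logarithmic time derivative of a wave packet, divided by `i`. -/
noncomputable def packetRate {n : ℕ} (ε : ℝ) (y ξ : RSpace n) (τ : ℝ) (x : RSpace n) : ℂ :=
  -(n : ℂ) / 2 / packetWidth ε τ - packetForm ε y ξ x / packetWidth ε τ ^ 2

theorem hasDerivAt_packet {n : ℕ} {ε : ℝ} (hε : 0 < ε) (y ξ : RSpace n) (τ : ℝ) (x : RSpace n) :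
    HasDerivAt (fun τ => packet ε y ξ τ x)
      (Complex.I * (packetRate ε y ξ τ x * packet ε y ξ τ x)) τ := by
  have hz := packetWidth_ne_zero hε τ
  have hw := hasDerivAt_packetWidth ε τ
  have h1 : HasDerivAt (fun z : ℂ => z ^ (((-(n : ℝ) / 2 : ℝ)) : ℂ)) _ (packetWidth ε τ) :=
    (hasDerivAt_id _).cpow_const (packetWidth_mem_slitPlane hε τ)
  have h1' := h1.comp τ hw
  have h2 : HasDerivAt (fun τ => Complex.exp (packetForm ε y ξ x / packetWidth ε τ)) _ τ :=
    ((hasDerivAt_const τ (packetForm ε y ξ x)).div hw hz).cexp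
  have h3 := (h1'.mul h2).const_mul (Complex.exp (-(2 * Real.pi ^ 2 * ε * ((‖ξ‖ ^ 2 : ℝ) : ℂ))))
  refine (h3.congr_deriv ?_).congr_of_eventuallyEq (Filter.Eventually.of_forall fun s => ?_)
  · simp only [id, Function.comp_apply, Pi.div_apply, packet, packetRate]
    rw [Complex.cpow_sub _ _ hz, Complex.cpow_one]
    push_cast
    field_simp
    ring
  · simp [packet, mul_assoc]

theorem packetForm_line {n : ℕ} (ε : ℝ) (y ξ x v : RSpace n) (s : ℝ) :
    packetForm ε y ξ (x + s • v) = packetForm ε y ξ x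
      + s * (-((inner ℝ (x - y) v : ℝ) : ℂ) + 2 * Real.pi * Complex.I * ε * ((inner ℝ v ξ : ℝ) : ℂ))
      - s ^ 2 * ((‖v‖ ^ 2 : ℝ) : ℂ) / 2 := by
  have hx : x + s • v - y = (x - y) + s • v := by abel
  rw [packetForm, packetForm, hx, norm_add_sq_real, inner_add_left, inner_smul_right,
    inner_smul_left, norm_smul, mul_pow, Real.norm_eq_abs, sq_abs]
  simp only [conj_trivial]
  push_cast
  ring

/-- The directional derivative of the quadratic form of a wave packet. -/
noncomputable def packetSlope {n : ℕ} (ε : ℝ) (y ξ v x : RSpace n) : ℂ :=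
  -((inner ℝ (x - y) v : ℝ) : ℂ) + 2 * Real.pi * Complex.I * ε * ((inner ℝ v ξ : ℝ) : ℂ)

theorem hasLineDerivAt_packet {n : ℕ} (ε : ℝ) (y ξ : RSpace n) (τ : ℝ) (x v : RSpace n) :
    HasLineDerivAt ℝ (packet ε y ξ τ)
      (packetSlope ε y ξ v x / packetWidth ε τ * packet ε y ξ τ x) x v := by
  have h0 : HasDerivAt (fun s : ℝ => (s : ℂ)) 1 0 := Complex.ofRealCLM.hasDerivAt
  have h1 : HasDerivAt (fun s : ℝ => packetForm ε y ξ (x + s • v)) (packetSlope ε y ξ v x) 0 := by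
    simp_rw [packetForm_line]
    have := ((h0.mul_const (packetSlope ε y ξ v x)).const_add (packetForm ε y ξ x)).sub
      (((h0.pow 2).mul_const ((‖v‖ ^ 2 : ℝ) : ℂ)).div_const 2)
    refine (this.congr_deriv (by simp)).congr_of_eventuallyEq
      (Filter.Eventually.of_forall fun s => ?_)
    simp [packetSlope]
  have h2 := ((h1.div_const (packetWidth ε τ)).cexp).const_mul
    (Complex.exp (-(2 * Real.pi ^ 2 * ε * ((‖ξ‖ ^ 2 : ℝ) : ℂ)))
      * packetWidth ε τ ^ (((-(n : ℝ) / 2 : ℝ)) : ℂ))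
  refine h2.congr_deriv ?_
  simp only [packet, zero_smul, add_zero]
  ring

theorem hasLineDerivAt_packetSlope {n : ℕ} (ε : ℝ) (y ξ x v : RSpace n) :
    HasLineDerivAt ℝ (packetSlope ε y ξ v) (-((‖v‖ ^ 2 : ℝ) : ℂ)) x v := by
  have h0 : HasDerivAt (fun s : ℝ => (s : ℂ)) 1 0 := Complex.ofRealCLM.hasDerivAt
  have h := (h0.mul_const (-((‖v‖ ^ 2 : ℝ) : ℂ))).const_add (packetSlope ε y ξ v x)
  rw [one_mul] at h
  refine h.congr_of_eventuallyEq (Filter.Eventually.of_forall fun s => ?_)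
  have hx : x + s • v - y = (x - y) + s • v := by abel
  simp only [packetSlope, hx, inner_add_left, inner_smul_left, real_inner_self_eq_norm_sq,
    conj_trivial]
  push_cast
  ring

/-- The form is `Q = -(w · w) / 2` with `w = x - y - 2πiεξ` and the bilinear dot product, and the
slopes are the components of `∇Q = -w`. -/
theorem sum_packetSlope_sq {n : ℕ} (ε : ℝ) (y ξ x : RSpace n) :
    ∑ i, packetSlope ε y ξ (EuclideanSpace.basisFun (Fin n) ℝ i) x ^ 2
      = -2 * packetForm ε y ξ x := by
  set b := EuclideanSpace.basisFun (Fin n) ℝ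
  have e1 : ∑ i, (inner ℝ (x - y) (b i) : ℝ) * inner ℝ (b i) (x - y) = ‖x - y‖ ^ 2 := by
    rw [b.sum_inner_mul_inner, real_inner_self_eq_norm_sq]
  have e2 : ∑ i, (inner ℝ (x - y) (b i) : ℝ) * inner ℝ (b i) ξ = inner ℝ (x - y) ξ :=
    b.sum_inner_mul_inner _ _
  have e3 : ∑ i, (inner ℝ ξ (b i) : ℝ) * inner ℝ (b i) ξ = ‖ξ‖ ^ 2 := by
    rw [b.sum_inner_mul_inner, real_inner_self_eq_norm_sq]
  rw [packetForm, ← e1, ← e2, ← e3]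
  push_cast
  simp only [Finset.mul_sum, Finset.sum_div, ← Finset.sum_neg_distrib, ← Finset.sum_add_distrib]
  refine Finset.sum_congr rfl fun i _ => ?_
  rw [packetSlope, real_inner_comm (b i) (x - y), real_inner_comm (b i) ξ]
  linear_combination (4 * Real.pi ^ 2 * ε ^ 2 * ((inner ℝ (b i) ξ : ℝ) : ℂ) ^ 2) * Complex.I_sq

/-- With `z` the width and `Q` the form, `Δ exp(Q/z) = (ΔQ / z + ∇Q·∇Q / z²) exp(Q/z)`, where `ΔQ =
-n` and `∇Q·∇Q = -2Q`. Together with `hasDerivAt_packet` this is the free equation `∂_τ = (i/2) Δ`.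
-/
theorem laplacian_packet {n : ℕ} {ε : ℝ} (hε : 0 < ε) (y ξ : RSpace n) (τ : ℝ)
    {φ : 𝓢(RSpace n, ℂ)} (hφ : ∀ x, φ x = packet ε y ξ τ x) (x : RSpace n) :
    (Δ φ) x = 2 * (packetRate ε y ξ τ x * packet ε y ξ τ x) := by
  have hz := packetWidth_ne_zero hε τ
  set b := EuclideanSpace.basisFun (Fin n) ℝ with hb
  have hφ' : (φ : RSpace n → ℂ) = packet ε y ξ τ := funext hφ
  have h1 : ∀ v x, (LineDeriv.lineDerivOp v φ) x
      = packetSlope ε y ξ v x / packetWidth ε τ * packet ε y ξ τ x := fun v x => by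
    rw [SchwartzMap.lineDerivOp_apply, hφ']
    exact (hasLineDerivAt_packet ε y ξ τ x v).lineDeriv
  have h2 : ∀ v x, (LineDeriv.lineDerivOp v (LineDeriv.lineDerivOp v φ)) x
      = (-((‖v‖ ^ 2 : ℝ) : ℂ) / packetWidth ε τ + packetSlope ε y ξ v x ^ 2 / packetWidth ε τ ^ 2)
        * packet ε y ξ τ x := fun v x => by
    rw [SchwartzMap.lineDerivOp_apply, show ((LineDeriv.lineDerivOp v φ : 𝓢(RSpace n, ℂ)) :
      RSpace n → ℂ) = fun x => packetSlope ε y ξ v x / packetWidth ε τ * packet ε y ξ τ x from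
      funext (h1 v)]
    have h3 : HasDerivAt (fun s : ℝ => packetSlope ε y ξ v (x + s • v) / packetWidth ε τ
        * packet ε y ξ τ (x + s • v)) _ 0 :=
      (HasDerivAt.div_const (hasLineDerivAt_packetSlope ε y ξ x v) (packetWidth ε τ)).mul
        (hasLineDerivAt_packet ε y ξ τ x v)
    rw [lineDeriv, h3.deriv]
    simp only [zero_smul, add_zero]
    ring
  rw [SchwartzMap.laplacian_eq_sum b, sum_apply]
  simp only [h2, ← Finset.sum_mul, Finset.sum_add_distrib]
  rw [← Finset.sum_div, ← Finset.sum_div, sum_packetSlope_sq]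
  simp only [b.norm_eq_one, packetRate]
  simp
  field_simp
  ring

/-! ### Domination of wave packets by real Gaussians -/

theorem memLp_gaussian {n : ℕ} {κ : ℝ} (hκ : 0 < κ) (c : ℝ) (y : RSpace n) (p : ℝ≥0∞) :
    MemLp (fun x : RSpace n => c * Real.exp (-κ * ‖x - y‖ ^ 2)) p volume := by
  obtain ⟨φ, hφ⟩ := exists_schwartzMap_gaussian (n := n) (β := (κ : ℂ)) (by simpa using hκ) 0 1 y 0
  have h := ((φ.memLp p).norm.const_mul c)
  refine h.congr_norm (by fun_prop) (Filter.Eventually.of_forall fun x => ?_)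
  simp [hφ, Complex.norm_exp, -Complex.ofReal_pow]

theorem norm_packet_le_gaussian {n : ℕ} {ε : ℝ} (hε : 0 < ε) (y ξ : RSpace n) {T τ : ℝ}
    (hτ : |τ| ≤ T) (x : RSpace n) : ‖packet ε y ξ τ x‖ ≤ ε ^ (-(n : ℝ) / 2) *
      Real.exp (-(ε / (2 * (ε ^ 2 + T ^ 2))) * ‖x - y - (2 * Real.pi * τ) • ξ‖ ^ 2) := by
  rw [norm_packet hε]
  have hT : τ ^ 2 ≤ T ^ 2 := sq_le_sq.2 (hτ.trans (le_abs_self T))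
  refine mul_le_mul (Real.rpow_le_rpow_of_nonpos hε (le_norm_packetWidth hε τ) ?_)
    (Real.exp_le_exp.2 ?_) (Real.exp_nonneg _) (by positivity)
  · rw [neg_div]
    exact neg_nonpos.2 (by positivity)
  · rw [neg_mul, neg_mul, neg_le_neg_iff]
    gcongr

theorem norm_packetRate_le {n : ℕ} {ε : ℝ} (hε : 0 < ε) (y ξ : RSpace n) (τ : ℝ) (x : RSpace n) :
    ‖packetRate ε y ξ τ x‖ ≤ (n / 2 / ε + (1 / 2 + 2 * Real.pi * ε * ‖ξ‖
      + 2 * Real.pi ^ 2 * ε ^ 2 * ‖ξ‖ ^ 2) / ε ^ 2) * (1 + ‖x - y‖) ^ 2 := by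
  have hz := le_norm_packetWidth hε τ
  have h0 : 0 ≤ ‖x - y‖ := norm_nonneg _
  have h1 : (1 : ℝ) ≤ (1 + ‖x - y‖) ^ 2 := by nlinarith
  have hQ : ‖packetForm ε y ξ x‖ ≤ (1 / 2 + 2 * Real.pi * ε * ‖ξ‖
      + 2 * Real.pi ^ 2 * ε ^ 2 * ‖ξ‖ ^ 2) * (1 + ‖x - y‖) ^ 2 := by
    rw [packetForm]
    refine (norm_add₃_le).trans ?_
    have e1 : ‖-((‖x - y‖ ^ 2 : ℝ) : ℂ) / 2‖ = ‖x - y‖ ^ 2 / 2 := by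
      rw [norm_div, norm_neg, Complex.norm_real, Real.norm_of_nonneg (by positivity)]; simp
    have e2 : ‖2 * Real.pi * Complex.I * ε * ((inner ℝ (x - y) ξ : ℝ) : ℂ)‖
        ≤ 2 * Real.pi * ε * (‖x - y‖ * ‖ξ‖) := by
      simp only [norm_mul, Complex.norm_real, Complex.norm_I, Real.norm_of_nonneg hε.le,
        Real.norm_of_nonneg Real.pi_pos.le, Complex.norm_ofNat, mul_one]
      gcongr
      exact norm_inner_le_norm _ _
    have e3 : ‖2 * Real.pi ^ 2 * ε ^ 2 * ((‖ξ‖ ^ 2 : ℝ) : ℂ)‖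
        = 2 * Real.pi ^ 2 * ε ^ 2 * ‖ξ‖ ^ 2 := by
      simp only [norm_mul, norm_pow, Complex.norm_real, Real.norm_of_nonneg hε.le,
        Real.norm_of_nonneg Real.pi_pos.le, Complex.norm_ofNat, norm_norm]
    rw [e1, e3]
    have f1 : ‖x - y‖ ^ 2 / 2 ≤ 1 / 2 * (1 + ‖x - y‖) ^ 2 := by nlinarith
    have f2 : 2 * Real.pi * ε * (‖x - y‖ * ‖ξ‖)
        ≤ 2 * Real.pi * ε * ‖ξ‖ * (1 + ‖x - y‖) ^ 2 := by
      rw [mul_comm ‖x - y‖, ← mul_assoc]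
      gcongr
      nlinarith
    have f3 : 2 * Real.pi ^ 2 * ε ^ 2 * ‖ξ‖ ^ 2
        ≤ 2 * Real.pi ^ 2 * ε ^ 2 * ‖ξ‖ ^ 2 * (1 + ‖x - y‖) ^ 2 :=
      le_mul_of_one_le_right (by positivity) h1
    linarith
  rw [packetRate]
  refine (norm_sub_le _ _).trans ?_
  rw [norm_div, norm_div, norm_div, norm_pow, norm_neg, Complex.norm_natCast, Complex.norm_ofNat,
    add_mul]
  gcongr
  · calc (n : ℝ) / 2 / ‖packetWidth ε τ‖ ≤ n / 2 / ε := by gcongr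
      _ ≤ _ := le_mul_of_one_le_right (by positivity) h1
  · calc _ ≤ ((1 / 2 + 2 * Real.pi * ε * ‖ξ‖
      + 2 * Real.pi ^ 2 * ε ^ 2 * ‖ξ‖ ^ 2) * (1 + ‖x - y‖) ^ 2) / ε ^ 2 := by gcongr
      _ = _ := by ring

theorem exists_dominating_packet {n : ℕ} {ε : ℝ} (hε : 0 < ε) (y ξ : RSpace n) (T : ℝ) :
    ∃ (G : RSpace n → ℝ) (B : ℝ), MemLp G 2 volume ∧ (∀ x, G x ≤ B) ∧ ∀ τ, |τ| ≤ T → ∀ x,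
      ‖packet ε y ξ τ x‖ ≤ G x ∧ ‖2 * (packetRate ε y ξ τ x * packet ε y ξ τ x)‖ ≤ G x := by
  -- A quarter of the worst Gaussian rate for `|τ| ≤ T`. Recentring at `y` costs half of the rate;
  -- of the two copies of `exp(-κ‖x - y‖²)` left, one absorbs the quadratic growth of the rate
  -- factor and the other remains as the majorant.
  set κ : ℝ := ε / (8 * (ε ^ 2 + T ^ 2)) with hκ_def
  have hκ : 0 < κ := by positivity
  set c : ℝ := ε ^ (-(n : ℝ) / 2) * Real.exp (4 * κ * (2 * Real.pi * T * ‖ξ‖) ^ 2) with hc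
  set D : ℝ := (n / 2 / ε + (1 / 2 + 2 * Real.pi * ε * ‖ξ‖
      + 2 * Real.pi ^ 2 * ε ^ 2 * ‖ξ‖ ^ 2) / ε ^ 2) with hD
  have hc0 : 0 ≤ c := by positivity
  have hD0 : 0 ≤ D := by positivity
  obtain ⟨K, hK0, hK⟩ := one_add_pow_mul_exp_neg_sq_le 2 hκ
  refine ⟨fun x => c * (1 + 2 * (D * K)) * Real.exp (-κ * ‖x - y‖ ^ 2), c * (1 + 2 * (D * K)),
    memLp_gaussian hκ _ y 2, fun x => ?_, fun τ hτ x => ?_⟩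
  · refine mul_le_of_le_one_right (by positivity) (Real.exp_le_one_iff.2 ?_)
    rw [neg_mul]
    exact neg_nonpos.2 (by positivity)
  · have h1 : ‖packet ε y ξ τ x‖
        ≤ c * (Real.exp (-κ * ‖x - y‖ ^ 2) * Real.exp (-κ * ‖x - y‖ ^ 2)) := by
      refine (norm_packet_le_gaussian hε y ξ hτ x).trans ?_
      rw [hc, ← Real.exp_add, mul_assoc (ε ^ (-(n : ℝ) / 2)), ← Real.exp_add]
      refine mul_le_mul_of_nonneg_left (Real.exp_le_exp.2 ?_) (by positivity)
      have h2 := half_norm_sq_sub_le (x - y) ((2 * Real.pi * τ) • ξ)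
      have h3 : ‖(2 * Real.pi * τ) • ξ‖ ^ 2 ≤ (2 * Real.pi * T * ‖ξ‖) ^ 2 := by
        rw [norm_smul, norm_mul, Real.norm_of_nonneg (by positivity : (0 : ℝ) ≤ 2 * Real.pi)]
        gcongr
        exact hτ
      have h4 : ε / (2 * (ε ^ 2 + T ^ 2)) = 4 * κ := by rw [hκ_def]; field_simp; ring
      rw [h4]
      nlinarith
    have hE : Real.exp (-κ * ‖x - y‖ ^ 2) ≤ 1 := Real.exp_le_one_iff.2 (by
      rw [neg_mul]
      exact neg_nonpos.2 (by positivity))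
    set e := Real.exp (-κ * ‖x - y‖ ^ 2) with he
    have he0 : 0 ≤ e := Real.exp_nonneg _
    constructor
    · refine h1.trans ?_
      change _ ≤ c * (1 + 2 * (D * K)) * e
      rw [mul_assoc c]
      refine mul_le_mul_of_nonneg_left (mul_le_mul_of_nonneg_right (hE.trans ?_) he0) hc0
      linarith [mul_nonneg hD0 hK0]
    · rw [norm_mul, norm_mul, Complex.norm_ofNat]
      have h5 := norm_packetRate_le hε y ξ τ x
      rw [← hD] at h5
      have h6 := hK ‖x - y‖ (norm_nonneg _)
      rw [← he] at h6
      calc 2 * (‖packetRate ε y ξ τ x‖ * ‖packet ε y ξ τ x‖)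
          ≤ 2 * ((D * (1 + ‖x - y‖) ^ 2) * (c * (e * e))) := by gcongr
        _ = c * (2 * (D * ((1 + ‖x - y‖) ^ 2 * e))) * e := by ring
        _ ≤ c * (1 + 2 * (D * K)) * e := by
          gcongr
          have : D * ((1 + ‖x - y‖) ^ 2 * e) ≤ D * K := by gcongr
          linarith

/-- Each packet is dominated by a translate of one fixed Gaussian. The bound depends on `ε`, but it
serves only to show that a supremum of coefficients is finite. -/
theorem exists_eLpNorm_packet_le {n : ℕ} {ε : ℝ} (hε : 0 < ε) (T : ℝ) :
    ∃ B : ℝ≥0, ∀ (y ξ : RSpace n) (τ : ℝ), |τ| ≤ T →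
      eLpNorm (packet ε y ξ τ) 2 volume ≤ B := by
  have hκ : 0 < ε / (2 * (ε ^ 2 + T ^ 2)) := by positivity
  have hm := memLp_gaussian (n := n) hκ (ε ^ (-(n : ℝ) / 2)) 0 2
  refine ⟨(eLpNorm (fun x : RSpace n => ε ^ (-(n : ℝ) / 2) *
    Real.exp (-(ε / (2 * (ε ^ 2 + T ^ 2))) * ‖x - 0‖ ^ 2)) 2 volume).toNNReal, fun y ξ τ hτ => ?_⟩
  rw [ENNReal.coe_toNNReal hm.2.ne,
    ← eLpNorm_comp_measurePreserving (p := 2) hm.1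
      (measurePreserving_sub_right volume (y + (2 * Real.pi * τ) • ξ))]
  refine eLpNorm_mono_real fun x => (norm_packet_le_gaussian hε y ξ hτ x).trans_eq ?_
  simp only [Function.comp_apply, sub_zero, sub_add_eq_sub_sub]

/-! ### The bilinear pairing on `L²` -/

theorem exists_clm_integral_mul {n : ℕ} {φ : RSpace n → ℂ} (hφ : MemLp φ 2 volume) :
    ∃ ℓ : Lp ℂ 2 (volume : Measure (RSpace n)) →L[ℂ] ℂ,
      (∀ f, ℓ f = ∫ x, f x * φ x) ∧ ‖ℓ‖ ≤ (eLpNorm φ 2 volume).toReal := by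
  have hs : MemLp (fun x => star (φ x)) 2 volume := hφ.star
  refine ⟨innerSL ℂ (hs.toLp _), fun f => ?_, ?_⟩
  · rw [innerSL_apply_apply, L2.inner_def]
    refine integral_congr_ae ?_
    filter_upwards [hs.coeFn_toLp] with x hx
    rw [hx]
    simp [RCLike.inner_apply]
  · rw [innerSL_apply_norm, Lp.norm_toLp]
    refine le_of_eq ?_
    congr 1
    exact eLpNorm_congr_norm_ae (Filter.Eventually.of_forall fun x => by simp)

/-! ### Testing a solution against a free evolution -/

/-- A family of Schwartz functions that solves the backward free Schrödinger equation and is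
dominated, on the time set `J`, by a bounded square integrable function. -/
structure IsFreeFamily {n : ℕ} (J : Set ℝ) (φ : ℝ → 𝓢(RSpace n, ℂ)) (G : RSpace n → ℝ) (B : ℝ) :
    Prop where
  memLp : MemLp G 2 volume
  le_bound : ∀ x, G x ≤ B
  norm_le : ∀ s ∈ J, ∀ x, ‖φ s x‖ ≤ G x
  norm_laplacian_le : ∀ s ∈ J, ∀ x, ‖(Δ (φ s)) x‖ ≤ G x
  hasDerivAt : ∀ s x, HasDerivAt (fun s => φ s x) (-(Complex.I / 2) * (Δ (φ s)) x) s
  continuous_laplacian : ∀ x, Continuous fun s => (Δ (φ s)) x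

namespace IsFreeFamily

variable {n : ℕ} {J : Set ℝ} {φ : ℝ → 𝓢(RSpace n, ℂ)} {G : RSpace n → ℝ} {B : ℝ}

theorem norm_deriv_le (h : IsFreeFamily J φ G B) {s : ℝ} (hs : s ∈ J) (x : RSpace n) :
    ‖-(Complex.I / 2) * (Δ (φ s)) x‖ ≤ G x := by
  rw [norm_mul, norm_neg, norm_div, Complex.norm_I, Complex.norm_ofNat]
  linarith [h.norm_laplacian_le s hs x, norm_nonneg ((Δ (φ s)) x)]

theorem integrable_bound (h : IsFreeFamily J φ G B)
    (f : Lp ℂ 2 (volume : Measure (RSpace n))) : Integrable (fun x => ‖f x‖ * G x) volume :=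
  (Lp.memLp f).norm.integrable_mul h.memLp

theorem hasDerivAt_integral (h : IsFreeFamily J φ G B) (hJ : IsOpen J)
    (f : Lp ℂ 2 (volume : Measure (RSpace n))) {s : ℝ} (hs : s ∈ J) :
    HasDerivAt (fun z => ∫ x, f x * φ z x) (-(Complex.I / 2) * ∫ x, f x * (Δ (φ s)) x) s := by
  have hm := (Lp.memLp f).1
  have h1 : ∀ z, AEStronglyMeasurable (fun x => f x * φ z x) volume := fun z =>
    hm.mul (φ z).continuous.aestronglyMeasurable
  have h2 : AEStronglyMeasurable (fun x => f x * (-(Complex.I / 2) * (Δ (φ s)) x)) volume :=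
    hm.mul ((Δ (φ s)).continuous.aestronglyMeasurable.const_mul _)
  have h3 : Integrable (fun x => f x * φ s x) volume :=
    (Lp.memLp f).integrable_mul ((φ s).memLp 2 volume)
  have h4 : ∀ x, ∀ z ∈ J, ‖f x * (-(Complex.I / 2) * (Δ (φ z)) x)‖ ≤ ‖f x‖ * G x := by
    intro x z hz
    rw [norm_mul]
    exact mul_le_mul_of_nonneg_left (h.norm_deriv_le hz x) (norm_nonneg _)
  have h5 := (hasDerivAt_integral_of_dominated_loc_of_deriv_le (hJ.mem_nhds hs)
    (Filter.Eventually.of_forall h1) h3 h2 (Filter.Eventually.of_forall h4) (h.integrable_bound f)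
    (Filter.Eventually.of_forall fun x z _ => (h.hasDerivAt z x).const_mul _)).2
  refine h5.congr_deriv ?_
  rw [← integral_const_mul]
  exact integral_congr_ae (Filter.Eventually.of_forall fun x => by ring)

theorem continuousAt_integral_laplacian (h : IsFreeFamily J φ G B) (hJ : IsOpen J)
    (f : Lp ℂ 2 (volume : Measure (RSpace n))) {s : ℝ} (hs : s ∈ J) :
    ContinuousAt (fun z => ∫ x, f x * (Δ (φ z)) x) s := by
  have h1 : ∀ z, AEStronglyMeasurable (fun x => f x * (Δ (φ z)) x) volume := fun z =>
    (Lp.memLp f).1.mul (Δ (φ z)).continuous.aestronglyMeasurable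
  refine continuousAt_of_dominated (Filter.Eventually.of_forall h1) ?_ (h.integrable_bound f)
    (Filter.Eventually.of_forall fun x => ((h.continuous_laplacian x).const_mul _).continuousAt)
  filter_upwards [hJ.mem_nhds hs] with z hz
  refine Filter.Eventually.of_forall fun x => ?_
  rw [norm_mul]
  exact mul_le_mul_of_nonneg_left (h.norm_laplacian_le z hz x) (norm_nonneg _)

theorem norm_sub_le (h : IsFreeFamily J φ G B) (hJ : Convex ℝ J) {r z : ℝ} (hr : r ∈ J)
    (hz : z ∈ J) (x : RSpace n) : ‖φ z x - φ r x‖ ≤ B * |z - r| :=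
  hJ.norm_image_sub_le_of_norm_hasDerivWithin_le (f := fun s => φ s x)
    (fun s _ => (h.hasDerivAt s x).hasDerivWithinAt)
    (fun _ hs => (h.norm_deriv_le hs x).trans (h.le_bound x)) hr hz

theorem eLpNorm_le (h : IsFreeFamily J φ G B) {s : ℝ} (hs : s ∈ J) :
    (eLpNorm (φ s) 2 volume).toReal ≤ (eLpNorm G 2 volume).toReal :=
  ENNReal.toReal_mono h.memLp.2.ne (eLpNorm_mono_real (h.norm_le s hs))

theorem eLpNorm_laplacian_le (h : IsFreeFamily J φ G B) {s : ℝ} (hs : s ∈ J) :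
    (eLpNorm (Δ (φ s) : 𝓢(RSpace n, ℂ)) 2 volume).toReal ≤ (eLpNorm G 2 volume).toReal :=
  ENNReal.toReal_mono h.memLp.2.ne (eLpNorm_mono_real (h.norm_laplacian_le s hs))

/-- A potential term depends in a Lipschitz way on the test function. -/
theorem norm_integral_le (h : IsFreeFamily J φ G B) (hJ : Convex ℝ J) {F : RSpace n → ℂ}
    (hF : Integrable F volume) {r z : ℝ} (hr : r ∈ J) (hz : z ∈ J) :
    ‖∫ x, F x * φ z x‖ ≤ ‖∫ x, F x * φ r x‖ + (∫ x, ‖F x‖) * (B * |z - r|) := by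
  have hi : ∀ z ∈ J, Integrable (fun x => F x * φ z x) volume := fun z hz =>
    hF.mul_bdd (φ z).continuous.aestronglyMeasurable
      (Filter.Eventually.of_forall fun x => (h.norm_le z hz x).trans (h.le_bound x))
  have e : ∫ x, F x * φ z x = (∫ x, F x * φ r x) + ∫ x, F x * (φ z x - φ r x) := by
    rw [← sub_eq_iff_eq_add', ← integral_sub (hi z hz) (hi r hr)]
    exact integral_congr_ae (Filter.Eventually.of_forall fun x => by ring)
  rw [e]
  refine (norm_add_le _ _).trans (add_le_add le_rfl ?_)
  rw [← integral_mul_const]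
  refine norm_integral_le_of_norm_le (hF.norm.mul_const _)
    (Filter.Eventually.of_forall fun x => ?_)
  rw [norm_mul]
  exact mul_le_mul_of_nonneg_left (h.norm_sub_le hJ hr hz x) (norm_nonneg _)

end IsFreeFamily

theorem integrable_mul_of_eLpNorm_two {n : ℕ} {W : RSpace n → ℂ} {M : ℝ≥0}
    (hWm : AEStronglyMeasurable W volume) (hW : eLpNorm W 2 volume ≤ M)
    (f : Lp ℂ 2 (volume : Measure (RSpace n))) :
    Integrable (fun x => W x * f x) volume ∧ ∫ x, ‖W x * f x‖ ≤ M * ‖f‖ := by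
  have hi : Integrable (fun x => W x * f x) volume :=
    MemLp.integrable_mul ⟨hWm, hW.trans_lt ENNReal.coe_lt_top⟩ (Lp.memLp f)
  refine ⟨hi, ?_⟩
  rw [integral_norm_eq_lintegral_enorm hi.1, ← eLpNorm_one_eq_lintegral_enorm]
  have h1 : eLpNorm (fun x => W x * f x) 1 volume ≤ M * eLpNorm f 2 volume :=
    (eLpNorm_smul_le_mul_eLpNorm (p := 2) (q := 2) (r := 1) (Lp.memLp f).1 hWm).trans
      (mul_le_mul_left hW _)
  refine (ENNReal.toReal_mono (ENNReal.mul_ne_top ENNReal.coe_ne_top (Lp.eLpNorm_ne_top _))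
    h1).trans ?_
  rw [ENNReal.toReal_mul, ENNReal.coe_toReal, ← Lp.norm_def]

namespace IsSchrodingerSolution

variable {n : ℕ} {I : Set ℝ} {V : ℝ → RSpace n → ℂ}
  {ψ₀ : Lp ℂ 2 (volume : Measure (RSpace n))} {ψ : ℝ → Lp ℂ 2 (volume : Measure (RSpace n))}

theorem integral_sub_integral (hψ : IsSchrodingerSolution I V ψ₀ ψ) (hI : I.OrdConnected)
    (h0 : (0 : ℝ) ∈ I) {p q : ℝ} (hp : p ∈ I) (hq : q ∈ I) (φ : 𝓢(RSpace n, ℂ)) :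
    (∫ x, ψ q x * φ x) - (∫ x, ψ p x * φ x)
      = Complex.I / 2 * (∫ r in p..q, ∫ x, ψ r x * (Δ φ) x)
        - Complex.I * (∫ r in p..q, ∫ x, V r x * ψ r x * φ x) := by
  obtain ⟨d, hd, -⟩ := exists_clm_integral_mul ((Δ φ).memLp 2 volume)
  have hint : ∀ t ∈ I, IntervalIntegrable (fun r => ∫ x, ψ r x * (Δ φ) x) volume 0 t := by
    intro t ht
    simp_rw [← hd]
    exact (d.continuous.comp_continuousOn
      (hψ.continuousOn.mono (hI.uIcc_subset h0 ht))).intervalIntegrable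
  have e1 := hψ.equation φ p hp
  have e2 := hψ.equation φ q hq
  rw [← intervalIntegral.integral_interval_sub_left (hint q hq) (hint p hp),
    ← intervalIntegral.integral_interval_sub_left (hψ.integrable φ q hq) (hψ.integrable φ p hp)]
  rw [one_div, Complex.inv_I] at e1 e2
  linear_combination Complex.I * (e2 - e1) + ((∫ x, ψ q x * φ x) - (∫ x, ψ p x * φ x))
    * Complex.I_sq

/-- A solution tested against a smooth family of Schwartz functions that solves the free adjoint
equation varies only through the potential. -/
theorem norm_integral_sub_integral_le (hψ : IsSchrodingerSolution I V ψ₀ ψ)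
    (hI : I.OrdConnected) (h0 : (0 : ℝ) ∈ I) {M : ℝ≥0}
    (hVm : ∀ t ∈ I, AEStronglyMeasurable (V t) volume)
    (hV : ∀ t ∈ I, eLpNorm (V t) 2 volume ≤ M)
    {p q : ℝ} (hpq : p ≤ q) (hp : p ∈ I) (hq : q ∈ I)
    {φ : ℝ → 𝓢(RSpace n, ℂ)} {G : RSpace n → ℝ} {B : ℝ}
    (hφ : IsFreeFamily (Set.Ioo (p - 1) (q + 1)) φ G B)
    {b : ℝ → ℝ} (hb : Continuous b)
    (hVb : ∀ r ∈ Set.Icc p q, ‖∫ x, V r x * ψ r x * φ r x‖ ≤ b r) :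
    ‖(∫ x, ψ q x * φ q x) - ∫ x, ψ p x * φ p x‖ ≤ ∫ r in p..q, b r := by
  have hsub : Set.Icc p q ⊆ I := hI.out hp hq
  set J : Set ℝ := Set.Ioo (p - 1) (q + 1) with hJ
  have hJo : IsOpen J := isOpen_Ioo
  have hIJ : Set.Icc p q ⊆ J := fun s hs => ⟨by linarith [hs.1], by linarith [hs.2]⟩
  have hB0 : 0 ≤ B := (norm_nonneg _).trans
    ((hφ.norm_le p (hIJ ⟨le_rfl, hpq⟩) 0).trans (hφ.le_bound 0))
  set Γ : ℝ := (eLpNorm G 2 volume).toReal with hΓ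
  have hΓ0 : 0 ≤ Γ := ENNReal.toReal_nonneg
  choose ℓ hℓ hℓn using fun s => exists_clm_integral_mul ((φ s).memLp 2 volume)
  choose d hd hdn using fun s => exists_clm_integral_mul ((Δ (φ s)).memLp 2 volume)
  have hℓΓ : ∀ s ∈ J, ‖ℓ s‖ ≤ Γ := fun s hs => (hℓn s).trans (hφ.eLpNorm_le hs)
  have hdΓ : ∀ s ∈ J, ‖d s‖ ≤ Γ := fun s hs => (hdn s).trans (hφ.eLpNorm_laplacian_le hs)
  have hderiv : ∀ f : Lp ℂ 2 (volume : Measure (RSpace n)), ∀ s ∈ J,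
      HasDerivAt (fun z => ℓ z f) (-(Complex.I / 2) * d s f) s := by
    intro f s hs
    simp_rw [hℓ, hd]
    exact hφ.hasDerivAt_integral hJo f hs
  have hdcont : ∀ f : Lp ℂ 2 (volume : Measure (RSpace n)), ∀ s ∈ J,
      ContinuousAt (fun z => d z f) s := by
    intro f s hs
    simp_rw [hd]
    exact hφ.continuousAt_integral_laplacian hJo f hs
  have hψc : ContinuousOn ψ (Set.Icc p q) := hψ.continuousOn.mono hsub
  obtain ⟨N, hN⟩ := isCompact_Icc.exists_bound_of_continuousOn hψc
  have hN0 : 0 ≤ N := (norm_nonneg _).trans (hN p ⟨le_rfl, hpq⟩)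
  -- The majorant `b r` is known only for the test function at the same time `r`; replacing it by
  -- the one at time `z` costs a Lipschitz error.
  have hVdiff : ∀ r ∈ Set.Icc p q, ∀ z ∈ J,
      ‖∫ x, V r x * ψ r x * φ z x‖ ≤ b r + M * N * (B * |z - r|) := by
    intro r hr z hz
    obtain ⟨h1, h2⟩ := integrable_mul_of_eLpNorm_two (hVm r (hsub hr)) (hV r (hsub hr)) (ψ r)
    refine (hφ.norm_integral_le (convex_Ioo _ _) h1 (hIJ hr) hz).trans
      (add_le_add (hVb r hr) (mul_le_mul_of_nonneg_right (h2.trans ?_) (by positivity)))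
    exact mul_le_mul_of_nonneg_left (hN r hr) M.2
  set m : ℝ → ℂ := fun s => ℓ s (ψ s) with hm
  have hgoal : ∀ s, ∫ x, ψ s x * φ s x = m s := fun s => (hℓ s _).symm
  have hmcont : ContinuousOn m (Set.Icc p q) := by
    intro s hs
    have h1 : Filter.Tendsto (fun z => ℓ z (ψ s)) (nhdsWithin s (Set.Icc p q)) (nhds (m s)) :=
      (hderiv (ψ s) s (hIJ hs)).continuousAt.continuousWithinAt
    have h2 : Filter.Tendsto (fun z => ℓ z (ψ z - ψ s)) (nhdsWithin s (Set.Icc p q))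
        (nhds 0) := by
      have h3 : Filter.Tendsto (fun z => Γ * ‖ψ z - ψ s‖) (nhdsWithin s (Set.Icc p q))
          (nhds 0) := by
        have h4 : Filter.Tendsto ψ (nhdsWithin s (Set.Icc p q)) (nhds (ψ s)) := hψc s hs
        simpa using ((tendsto_sub_nhds_zero_iff.2 h4).norm).const_mul Γ
      refine squeeze_zero_norm' ?_ h3
      filter_upwards [self_mem_nhdsWithin] with z hz
      exact (ℓ z).le_of_opNorm_le (hℓΓ z (hIJ hz)) _
    have h5 := h1.add h2
    rw [add_zero] at h5
    refine h5.congr fun z => ?_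
    rw [← map_add, add_sub_cancel]
  have hbi : ∀ u v : ℝ, IntervalIntegrable b volume u v := fun u v => hb.intervalIntegrable u v
  -- A differential inequality for right slopes, so that only the bound `b`, and no measurability in
  -- `r` of the potential term with moving test function, is needed.
  have main := image_le_of_liminf_slope_right_le_deriv_boundary (a := p) (b := q)
    (f := fun s => ‖m s - m p‖) (B := fun s => ∫ r in p..s, b r) (B' := b)
    (hmcont.sub continuousOn_const).norm (by simp)
    (intervalIntegral.continuous_primitive hbi p).continuousOn
    (fun s _ => (hb.integral_hasStrictDerivAt p s).hasDerivAt.hasDerivWithinAt)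
    (fun s hs c hc => by
      have hsI : s ∈ Set.Icc p q := ⟨hs.1, hs.2.le⟩
      have hsJ := hIJ hsI
      -- Five parts: the slope is at most `b s + 4η` (one `η` from the Laplacian term after the
      -- factor `1/2`, two from the potential, one from the differentiability remainder), and the
      -- fifth makes the inequality strict.
      set η : ℝ := (c - b s) / 5 with hη
      have hη0 : 0 < η := by rw [hη]; linarith
      have c1 : ∀ᶠ z in nhdsWithin s (Set.Ioi s), z ∈ Set.Ioc s q :=
        Ioc_mem_nhdsGT hs.2
      have c2 : ∀ᶠ z in nhdsWithin s (Set.Ioi s), ∀ r ∈ Set.Icc s z,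
          b r ≤ b s + η ∧ Γ * ‖ψ r - ψ s‖ ≤ η := by
        have g1 : ∀ᶠ r in nhdsWithin s (Set.Icc p q), b r ≤ b s + η :=
          (hb.continuousWithinAt.eventually_lt_const (by linarith)).mono fun r hr => le_of_lt hr
        have g2 : ∀ᶠ r in nhdsWithin s (Set.Icc p q), Γ * ‖ψ r - ψ s‖ ≤ η := by
          have h4 : Filter.Tendsto ψ (nhdsWithin s (Set.Icc p q)) (nhds (ψ s)) := hψc s hsI
          have h5 := ((tendsto_sub_nhds_zero_iff.2 h4).norm).const_mul Γ
          rw [norm_zero, mul_zero] at h5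
          exact (h5.eventually_lt_const hη0).mono fun r hr => le_of_lt hr
        have g3 := g1.and g2
        rw [eventually_nhdsWithin_iff, Metric.eventually_nhds_iff] at g3
        obtain ⟨ρ, hρ, hr⟩ := g3
        have : ∀ᶠ z in nhdsWithin s (Set.Ioi s), z ∈ Set.Ioo s (s + ρ) :=
          Ioo_mem_nhdsGT (by linarith)
        filter_upwards [this, c1] with z hz hz' r hrz
        exact hr (by rw [Real.dist_eq, abs_of_nonneg (by linarith [hrz.1])]; linarith [hrz.2, hz.2])
          ⟨hs.1.trans hrz.1, hrz.2.trans hz'.2⟩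
      have c3 : ∀ᶠ z in nhdsWithin s (Set.Ioi s), ‖d z (ψ s) - d s (ψ s)‖ ≤ η := by
        have h5 := (tendsto_sub_nhds_zero_iff.2 (hdcont (ψ s) s hsJ)).norm
        rw [norm_zero] at h5
        exact ((h5.eventually_lt_const hη0).mono fun r hr => le_of_lt hr).filter_mono
          nhdsWithin_le_nhds
      have c4 : ∀ᶠ z in nhdsWithin s (Set.Ioi s),
          ‖ℓ z (ψ s) - ℓ s (ψ s) - (z - s) • (-(Complex.I / 2) * d s (ψ s))‖ ≤ η * ‖z - s‖ :=
        ((hasDerivAt_iff_isLittleO.1 (hderiv (ψ s) s hsJ)).def hη0).filter_mono nhdsWithin_le_nhds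
      have c5 : ∀ᶠ z in nhdsWithin s (Set.Ioi s), M * N * (B * (z - s)) ≤ η := by
        have h5 : Filter.Tendsto (fun z : ℝ => M * N * (B * (z - s))) (nhds s) (nhds 0) := by
          have : Continuous fun z : ℝ => M * N * (B * (z - s)) := by fun_prop
          simpa using this.tendsto s
        exact ((h5.eventually_lt_const hη0).mono fun r hr => le_of_lt hr).filter_mono
          nhdsWithin_le_nhds
      refine Filter.Eventually.frequently ?_
      filter_upwards [c1, c2, c3, c4, c5] with z z1 z2 z3 z4 z5
      have hzs : 0 < z - s := by linarith [z1.1]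
      have hzI : z ∈ Set.Icc p q := ⟨hs.1.trans z1.1.le, z1.2⟩
      have hzJ := hIJ hzI
      have hrI : ∀ r ∈ Set.Icc s z, r ∈ Set.Icc p q := fun r hr =>
        ⟨hs.1.trans hr.1, hr.2.trans z1.2⟩
      -- On `[s, z]` the equation is applied to the frozen test function `φ z`. Its Laplacian term
      -- is cancelled to leading order by the derivative of `φ`.
      have eq1 : m z - m s = Complex.I / 2 * (∫ r in s..z, (d z (ψ r) - d s (ψ s)))
          - Complex.I * (∫ r in s..z, ∫ x, V r x * ψ r x * φ z x)
          + (ℓ z (ψ s) - ℓ s (ψ s) - (z - s) • (-(Complex.I / 2) * d s (ψ s))) := by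
        have h6 := hψ.integral_sub_integral hI h0 (hsub hsI) (hsub hzI) (φ z)
        simp_rw [← hℓ, ← hd] at h6
        have h7 : IntervalIntegrable (fun r => d z (ψ r)) volume s z := by
          refine ((d z).continuous.comp_continuousOn (hψc.mono ?_)).intervalIntegrable
          rw [Set.uIcc_of_le z1.1.le]
          exact hrI
        rw [intervalIntegral.integral_sub h7 intervalIntegrable_const,
          intervalIntegral.integral_const]
        simp only [hm, Complex.real_smul]
        linear_combination h6
      have b1 : ‖∫ r in s..z, (d z (ψ r) - d s (ψ s))‖ ≤ (η + η) * |z - s| := by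
        refine intervalIntegral.norm_integral_le_of_norm_le_const fun r hr => ?_
        rw [Set.uIoc_of_le z1.1.le] at hr
        have hr' : r ∈ Set.Icc s z := ⟨hr.1.le, hr.2⟩
        have : d z (ψ r) - d s (ψ s) = d z (ψ r - ψ s) + (d z (ψ s) - d s (ψ s)) := by
          rw [map_sub]; ring
        rw [this]
        refine (norm_add_le _ _).trans (add_le_add ?_ z3)
        exact ((d z).le_of_opNorm_le (hdΓ z hzJ) _).trans (z2 r hr').2
      have b2 : ‖∫ r in s..z, ∫ x, V r x * ψ r x * φ z x‖ ≤ (b s + η + η) * |z - s| := by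
        refine intervalIntegral.norm_integral_le_of_norm_le_const fun r hr => ?_
        rw [Set.uIoc_of_le z1.1.le] at hr
        have hr' : r ∈ Set.Icc s z := ⟨hr.1.le, hr.2⟩
        refine (hVdiff r (hrI r hr') z hzJ).trans (add_le_add (z2 r hr').1 (le_trans ?_ z5))
        rw [abs_of_nonneg (by linarith [hr.2])]
        have : z - r ≤ z - s := by linarith [hr.1]
        have hMN : 0 ≤ M * N := mul_nonneg M.2 hN0
        gcongr
      rw [abs_of_pos hzs] at b1 b2
      rw [Real.norm_of_nonneg hzs.le] at z4
      have b3 : ‖m z - m s‖ ≤ (b s + 4 * η) * (z - s) := by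
        rw [eq1]
        refine (norm_add_le _ _).trans ?_
        refine (add_le_add_left (norm_sub_le _ _) _).trans ?_
        rw [norm_mul, norm_mul, norm_div, Complex.norm_I, Complex.norm_ofNat]
        nlinarith
      rw [slope_def_field, div_lt_iff₀ hzs]
      have b4 : ‖m z - m p‖ - ‖m s - m p‖ ≤ ‖m z - m s‖ := by
        have := norm_sub_norm_le (m z - m p) (m s - m p)
        rwa [sub_sub_sub_cancel_right] at this
      refine (b4.trans b3).trans_lt ?_
      have : b s + 4 * η < c := by rw [hη]; linarith
      exact mul_lt_mul_of_pos_right this hzs)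
  rw [hgoal, hgoal]
  exact main ⟨hpq, le_rfl⟩

end IsSchrodingerSolution

/-! ### Wave packets as test families -/

theorem exists_isFreeFamily_packet {n : ℕ} {ε : ℝ} (hε : 0 < ε) (y ξ : RSpace n) (t p q : ℝ) :
    ∃ (φ : ℝ → 𝓢(RSpace n, ℂ)) (G : RSpace n → ℝ) (B : ℝ),
      (∀ s x, φ s x = packet ε y ξ (t - s) x) ∧ IsFreeFamily (Set.Ioo (p - 1) (q + 1)) φ G B := by
  choose φ hφ using fun s => exists_schwartzMap_packet hε y ξ (t - s)
  obtain ⟨G, B, hG, hGB, hb⟩ := exists_dominating_packet hε y ξ (|t - (p - 1)| + |t - (q + 1)|)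
  have hT : ∀ s ∈ Set.Ioo (p - 1) (q + 1), |t - s| ≤ |t - (p - 1)| + |t - (q + 1)| := by
    intro s hs
    have h1 := le_abs_self (t - (p - 1))
    have h2 := neg_abs_le (t - (q + 1))
    have h3 := abs_nonneg (t - (p - 1))
    have h4 := abs_nonneg (t - (q + 1))
    rw [abs_le]
    constructor <;> linarith [hs.1, hs.2]
  refine ⟨φ, G, B, hφ, hG, hGB, fun s hs x => ?_, fun s hs x => ?_, fun s x => ?_, fun x => ?_⟩
  · rw [hφ]
    exact (hb _ (hT s hs) x).1
  · rw [laplacian_packet hε y ξ (t - s) (hφ s)]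
    exact (hb _ (hT s hs) x).2
  · rw [laplacian_packet hε y ξ (t - s) (hφ s)]
    simp_rw [hφ]
    have h := (hasDerivAt_packet hε y ξ (t - s) x).scomp s ((hasDerivAt_id s).const_sub t)
    refine h.congr_deriv ?_
    rw [neg_one_smul]
    ring
  · have e : (fun s => (Δ (φ s)) x)
        = fun s => 2 * (packetRate ε y ξ (t - s) x * packet ε y ξ (t - s) x) :=
      funext fun s => laplacian_packet hε y ξ (t - s) (hφ s) x
    rw [e]
    have hts : Continuous fun s : ℝ => t - s := by fun_prop
    have h1 : Continuous fun τ => packet ε y ξ τ x :=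
      continuous_iff_continuousAt.2 fun τ => (hasDerivAt_packet hε y ξ τ x).continuousAt
    have h2 : Continuous (packetWidth ε) :=
      continuous_iff_continuousAt.2 fun τ => (hasDerivAt_packetWidth ε τ).continuousAt
    have h3 : Continuous fun τ => packetRate ε y ξ τ x :=
      (continuous_const.div h2 (packetWidth_ne_zero hε)).sub
        (continuous_const.div (h2.pow 2) fun τ => pow_ne_zero 2 (packetWidth_ne_zero hε τ))
    exact continuous_const.mul ((h3.comp hts).mul (h1.comp hts))

theorem continuous_packet {n : ℕ} {ε : ℝ} (hε : 0 < ε) (y ξ : RSpace n) (τ : ℝ) :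
    Continuous (packet ε y ξ τ) := by
  obtain ⟨φ, hφ⟩ := exists_schwartzMap_packet hε y ξ τ
  rw [← funext hφ]
  exact φ.continuous

theorem memLp_packet {n : ℕ} {ε : ℝ} (hε : 0 < ε) (y ξ : RSpace n) (τ : ℝ) (p : ℝ≥0∞) :
    MemLp (packet ε y ξ τ) p volume := by
  obtain ⟨φ, hφ⟩ := exists_schwartzMap_packet hε y ξ τ
  rw [← funext hφ]
  exact φ.memLp p volume

namespace IsSchrodingerSolution

/-- A solution tested against a wave packet varies only through the potential. -/
theorem norm_integral_packet_sub_le {n : ℕ} {I : Set ℝ} {V : ℝ → RSpace n → ℂ}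
    {ψ₀ : Lp ℂ 2 (volume : Measure (RSpace n))} {ψ : ℝ → Lp ℂ 2 (volume : Measure (RSpace n))}
    (hψ : IsSchrodingerSolution I V ψ₀ ψ) (hI : I.OrdConnected) (h0 : (0 : ℝ) ∈ I) {M : ℝ≥0}
    (hVm : ∀ t ∈ I, AEStronglyMeasurable (V t) volume)
    (hV : ∀ t ∈ I, eLpNorm (V t) 2 volume ≤ M)
    {ε : ℝ} (hε : 0 < ε) (y ξ : RSpace n) (t : ℝ) {p q : ℝ} (hp : p ∈ I) (hq : q ∈ I)
    {b : ℝ → ℝ} (hb : Continuous b)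
    (hVb : ∀ r ∈ Set.uIcc p q, ‖∫ x, V r x * ψ r x * packet ε y ξ (t - r) x‖ ≤ b r) :
    ‖(∫ x, ψ q x * packet ε y ξ (t - q) x) - ∫ x, ψ p x * packet ε y ξ (t - p) x‖
      ≤ |∫ r in p..q, b r| := by
  rcases le_total p q with hpq | hpq
  · obtain ⟨φ, G, B, hφ, hF⟩ := exists_isFreeFamily_packet hε y ξ t p q
    rw [Set.uIcc_of_le hpq] at hVb
    simp_rw [← hφ] at hVb ⊢
    exact (hψ.norm_integral_sub_integral_le hI h0 hVm hV hpq hp hq hF hb hVb).trans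
      (le_abs_self _)
  · obtain ⟨φ, G, B, hφ, hF⟩ := exists_isFreeFamily_packet hε y ξ t q p
    rw [Set.uIcc_of_ge hpq] at hVb
    simp_rw [← hφ] at hVb ⊢
    rw [norm_sub_rev, intervalIntegral.integral_symm, abs_neg]
    exact (hψ.norm_integral_sub_integral_le hI h0 hVm hV hpq hq hp hF hb hVb).trans
      (le_abs_self _)

end IsSchrodingerSolution

/-! ### Potentials with integrable Fourier transform -/

theorem continuous_fourier {n : ℕ} {f : RSpace n → ℂ} (hf : Integrable f volume) :
    Continuous (𝓕 f) :=
  VectorFourier.fourierIntegral_continuous Real.continuous_fourierChar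
    (by exact continuous_inner) hf

theorem integral_fourier_mul {n : ℕ} {f g : RSpace n → ℂ} (hf : Integrable f volume)
    (hg : Integrable g volume) : ∫ x, 𝓕 f x * g x = ∫ x, f x * 𝓕 g x := by
  have := VectorFourier.integral_fourierIntegral_smul_eq_flip (L := innerₗ (RSpace n))
    Real.continuous_fourierChar (by exact continuous_inner) hf hg
  rw [flip_innerₗ] at this
  exact this

theorem integral_fourierInv_mul {n : ℕ} {f g : RSpace n → ℂ} (hf : Integrable f volume)
    (hg : Integrable g volume) : ∫ x, 𝓕⁻ f x * g x = ∫ x, f x * 𝓕⁻ g x := by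
  rw [← integral_neg_eq_self]
  simp_rw [Real.fourierInv_eq_fourier_neg f, neg_neg]
  rw [integral_fourier_mul hf hg.comp_neg, Real.fourierInv_eq_fourier_comp_neg g]

/-- Without continuity of `f`, inversion holds almost everywhere: tested against a smooth compactly
supported function, both transforms move onto it, where Schwartz inversion applies. -/
theorem fourierInv_fourier_ae_eq {n : ℕ} {f : RSpace n → ℂ} (hf : Integrable f volume)
    (hf' : Integrable (𝓕 f) volume) : 𝓕⁻ (𝓕 f) =ᵐ[volume] f := by
  have hc : Continuous (𝓕⁻ (𝓕 f)) := by
    rw [Real.fourierInv_eq_fourier_comp_neg]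
    exact continuous_fourier hf'.comp_neg
  refine ae_eq_of_integral_contDiff_smul_eq hc.locallyIntegrable hf.locallyIntegrable
    fun g hg hgc => ?_
  have hg1 : ContDiff ℝ (⊤ : ℕ∞) fun x => (g x : ℂ) := Complex.ofRealCLM.contDiff.comp hg
  have hg2 : HasCompactSupport fun x => (g x : ℂ) := hgc.comp_left Complex.ofReal_zero
  set φ : 𝓢(RSpace n, ℂ) := hg2.toSchwartzMap hg1 with hφ
  have hφx : ∀ x, φ x = g x := fun x => rfl
  have h1 : ∀ h : RSpace n → ℂ, ∫ x, g x • h x = ∫ x, h x * φ x := fun h =>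
    integral_congr_ae (Filter.Eventually.of_forall fun x => by
      simp only [hφx, Complex.real_smul, mul_comm])
  rw [h1, h1, integral_fourierInv_mul hf' φ.integrable, ← SchwartzMap.fourierInv_coe,
    integral_fourier_mul hf (SchwartzMap.integrable _), ← SchwartzMap.fourier_coe,
    FourierTransform.fourier_fourierInv_eq]

/-- Inversion for `W` and the multiplication formula give `∫ W F = ∫ 𝓕 W · 𝓕⁻ F`, and `K` is a
uniform bound for `𝓕⁻ F`. -/
theorem norm_integral_mul_le_of_eLpNorm_fourier_le {n : ℕ} {W F : RSpace n → ℂ} {M : ℝ≥0} {K : ℝ}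
    (hW : Integrable W volume) (hM : eLpNorm (𝓕 W) 1 volume ≤ M) (hF : Integrable F volume)
    (hK : ∀ ζ : RSpace n,
      ‖∫ x, Complex.exp ((2 * Real.pi * inner ℝ x ζ : ℝ) * Complex.I) * F x‖ ≤ K) :
    ‖∫ x, W x * F x‖ ≤ M * K := by
  have hK0 : 0 ≤ K := (norm_nonneg _).trans (hK 0)
  have hW' : Integrable (𝓕 W) volume := memLp_one_iff_integrable.1
    ⟨(continuous_fourier hW).aestronglyMeasurable, hM.trans_lt ENNReal.coe_lt_top⟩
  have e : ∫ x, W x * F x = ∫ x, 𝓕 W x * 𝓕⁻ F x := by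
    rw [← integral_fourierInv_mul hW' hF]
    refine integral_congr_ae ?_
    filter_upwards [fourierInv_fourier_ae_eq hW hW'] with x hx
    rw [hx]
  rw [e]
  refine (norm_integral_le_of_norm_le (hW'.norm.mul_const K)
    (Filter.Eventually.of_forall fun ζ => ?_)).trans ?_
  · rw [norm_mul, Real.fourierInv_eq']
    exact mul_le_mul_of_nonneg_left (hK ζ) (norm_nonneg _)
  · rw [integral_mul_const, integral_norm_eq_lintegral_enorm hW'.1,
      ← eLpNorm_one_eq_lintegral_enorm]
    refine mul_le_mul_of_nonneg_right ?_ hK0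
    exact ENNReal.toReal_mono ENNReal.coe_ne_top hM

/-! ### Hölder's inequality for the sum space -/

theorem eLpNorm_mul_le_normInter_mul_normSum {n : ℕ} {W f : RSpace n → ℂ} {M : ℝ≥0}
    (hWm : AEStronglyMeasurable W volume) (hW : normInter W ≤ M) :
    eLpNorm (fun x => W x * f x) 1 volume ≤ M * normSum f := by
  have key : ∀ (h g : RSpace n → ℂ), MemLp h 2 volume → MemLp g ∞ volume →
      (f =ᵐ[volume] fun x => h x + g x) → eLpNorm (fun x => W x * f x) 1 volume
        ≤ M * (eLpNorm h 2 volume + eLpNorm g ∞ volume) := by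
    intro h g hh hg hfg
    have e : (fun x => W x * f x) =ᵐ[volume] (W • h + W • g) := by
      filter_upwards [hfg] with x hx
      simp [hx, mul_add]
    rw [eLpNorm_congr_ae e, mul_add]
    refine (eLpNorm_add_le (hWm.smul hh.1) (hWm.smul hg.1) le_rfl).trans (add_le_add ?_ ?_)
    · exact (eLpNorm_smul_le_mul_eLpNorm (p := 2) (q := 2) (r := 1) hh.1 hWm).trans
        (mul_le_mul_left ((le_max_right _ _).trans hW) _)
    · exact (eLpNorm_smul_le_mul_eLpNorm (p := 1) (q := ∞) (r := 1) hg.1 hWm).trans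
        (mul_le_mul_left ((le_max_left _ _).trans hW) _)
  -- The infimum is reached by dividing by `M`, so `M = 0` is separate; there `W` vanishes almost
  -- everywhere.
  rcases eq_or_ne M 0 with rfl | hM
  · have hW0 : eLpNorm W 1 volume = 0 := by
      simpa using (le_max_left _ _).trans hW
    have hW0' := (eLpNorm_eq_zero_iff hWm one_ne_zero).1 hW0
    have : (fun x => W x * f x) =ᵐ[volume] 0 := by
      filter_upwards [hW0'] with x hx
      simp [hx]
    rw [eLpNorm_congr_ae this]
    simp
  · rw [mul_comm, ← ENNReal.div_le_iff (by simpa using hM) ENNReal.coe_ne_top]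
    refine le_iInf fun h => le_iInf fun g => le_iInf fun hh => le_iInf fun hg => le_iInf fun e => ?_
    rw [ENNReal.div_le_iff (by simpa using hM) ENNReal.coe_ne_top, mul_comm]
    exact key h g hh hg e

/-! ### Pointwise bounds from Gaussian averages -/

theorem packet_zero {n : ℕ} {ε : ℝ} (hε : 0 < ε) (y x : RSpace n) :
    packet ε y 0 0 x
      = ((ε ^ (-(n : ℝ) / 2) * Real.exp (-(1 / (2 * ε)) * ‖x - y‖ ^ 2) : ℝ) : ℂ) := by
  simp only [packet, packetForm, packetWidth, norm_zero, inner_zero_right]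
  rw [Complex.ofReal_mul, Complex.ofReal_exp, Complex.ofReal_cpow hε.le]
  simp only [ne_eq, OfNat.ofNat_ne_zero, not_false_eq_true, zero_pow, Complex.ofReal_zero, mul_zero,
    neg_zero, Complex.exp_zero, one_mul, zero_mul, add_zero]
  congr 2
  push_cast
  have : (ε : ℂ) ≠ 0 := by exact_mod_cast hε.ne'
  field_simp

theorem integral_packet_mul_eq {n : ℕ} {R : ℝ} (hR : 0 < R) (c : RSpace n → ℂ) :
    ∫ w, packet (R ^ 2) 0 0 0 w * c w
      = ∫ v, (Real.exp (-(1 / 2) * ‖v‖ ^ 2) : ℂ) * c (R • v) := by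
  have h := Measure.integral_comp_smul (volume : Measure (RSpace n))
    (fun w => (Real.exp (-(1 / (2 * R ^ 2)) * ‖w‖ ^ 2) : ℂ) * c w) R
  have e : ∀ v : RSpace n, -(1 / (2 * R ^ 2)) * ‖R • v‖ ^ 2 = -(1 / 2) * ‖v‖ ^ 2 := fun v => by
    rw [norm_smul, Real.norm_of_nonneg hR.le]
    field_simp
  simp only [e] at h
  rw [h, abs_of_pos (by positivity), finrank_euclideanSpace_fin, Complex.real_smul,
    ← integral_const_mul]
  refine integral_congr_ae (Filter.Eventually.of_forall fun w => ?_)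
  have e2 : (R ^ 2) ^ (-(n : ℝ) / 2) = (R ^ n)⁻¹ := by
    rw [← Real.rpow_natCast R 2, ← Real.rpow_mul hR.le, ← Real.rpow_natCast R n,
      ← Real.rpow_neg hR.le]
    congr 1
    push_cast
    ring
  simp only [packet_zero (by positivity : 0 < R ^ 2), sub_zero, e2]
  push_cast
  ring

/-- Rescaling by `R` turns the packet into a fixed Gaussian and dominated convergence gives `c 0`
times its mass as `R → 0`. The mass `(2π)^{n/2}` is at least 1, so it can be dropped. -/
theorem norm_le_of_forall_norm_integral_packet_le {n : ℕ} {c : RSpace n → ℂ} {K B : ℝ}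
    (hc : Continuous c) (hK : ∀ w, ‖c w‖ ≤ K)
    (hB : ∀ R : ℝ, 0 < R → ‖∫ w, packet (R ^ 2) 0 0 0 w * c w‖ ≤ B) : ‖c 0‖ ≤ B := by
  set g : RSpace n → ℝ := fun v => Real.exp (-(1 / 2) * ‖v‖ ^ 2) with hg
  have hgi : Integrable g volume := by
    have := memLp_gaussian (n := n) (by norm_num : (0 : ℝ) < 1 / 2) 1 0 1
    simpa [hg] using memLp_one_iff_integrable.1 this
  have hint : (1 : ℝ) ≤ ∫ v, g v := by
    rw [hg, GaussianFourier.integral_rexp_neg_mul_sq_norm (by norm_num)]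
    refine Real.one_le_rpow ?_ (by positivity)
    linarith [Real.pi_gt_three]
  have hlim : Filter.Tendsto (fun R : ℝ => ∫ v, (g v : ℂ) * c (R • v))
      (nhdsWithin 0 (Set.Ioi 0)) (nhds (∫ v, (g v : ℂ) * c ((0 : ℝ) • v))) := by
    refine tendsto_integral_filter_of_dominated_convergence (fun v => g v * K)
      (Filter.Eventually.of_forall fun R => ?_) (Filter.Eventually.of_forall fun R =>
        Filter.Eventually.of_forall fun v => ?_) (hgi.mul_const K)
      (Filter.Eventually.of_forall fun v => ?_)
    · exact (Complex.continuous_ofReal.comp_aestronglyMeasurable hgi.1).mul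
        (hc.comp (continuous_const_smul R)).aestronglyMeasurable
    · rw [norm_mul, Complex.norm_real, Real.norm_of_nonneg (Real.exp_nonneg _)]
      exact mul_le_mul_of_nonneg_left (hK _) (Real.exp_nonneg _)
    · have : Continuous fun R : ℝ => (g v : ℂ) * c (R • v) := by fun_prop
      exact (this.tendsto 0).mono_left nhdsWithin_le_nhds
  have h1 : ‖∫ v, (g v : ℂ) * c ((0 : ℝ) • v)‖ ≤ B := by
    refine le_of_tendsto hlim.norm ?_
    filter_upwards [self_mem_nhdsWithin] with R hR
    have := hB R hR
    rwa [integral_packet_mul_eq hR] at this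
  simp only [zero_smul] at h1
  rw [integral_mul_const, integral_complex_ofReal, norm_mul, Complex.norm_real,
    Real.norm_of_nonneg (by linarith)] at h1
  exact (le_mul_of_one_le_left (norm_nonneg _) hint).trans h1

theorem eLpNorm_reflect {n : ℕ} {c : RSpace n → ℂ} {p : ℝ≥0∞} (hc : MemLp c p volume)
    (z w : RSpace n) : eLpNorm (fun x => c (z - x - w)) p volume = eLpNorm c p volume := by
  have e : (fun x => c (z - x - w)) = c ∘ fun x => (z - w) - x := by
    funext x
    rw [Function.comp_apply, sub_right_comm]
  rw [e, eLpNorm_comp_measurePreserving hc.1 (Measure.measurePreserving_sub_left volume (z - w))]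

theorem integrable_prod_mul_shift {n : ℕ} {a c : RSpace n → ℂ} (ha : Continuous a)
    (hai : Integrable a volume) (hc : Continuous c) (hc2 : MemLp c 2 volume)
    (f : Lp ℂ 2 (volume : Measure (RSpace n))) (z : RSpace n) :
    Integrable (Function.uncurry fun w x => a w * (f x * c (z - x - w)))
      ((volume : Measure (RSpace n)).prod volume) := by
  have hm : AEStronglyMeasurable (Function.uncurry fun w x => a w * (f x * c (z - x - w)))
      ((volume : Measure (RSpace n)).prod volume) := by
    have h1 : AEStronglyMeasurable (fun p : RSpace n × RSpace n => f p.2)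
        ((volume : Measure (RSpace n)).prod volume) := (Lp.memLp f).1.comp_snd
    have h2 : Continuous fun p : RSpace n × RSpace n => c (z - p.2 - p.1) := by fun_prop
    exact (ha.comp continuous_fst).aestronglyMeasurable.mul (h1.mul h2.aestronglyMeasurable)
  have hW : ∀ w, eLpNorm (fun x => c (z - x - w)) 2 volume ≤ (eLpNorm c 2 volume).toNNReal :=
    fun w => (eLpNorm_reflect hc2 z w).trans_le (ENNReal.coe_toNNReal hc2.2.ne).ge
  have hWm : ∀ w, AEStronglyMeasurable (fun x => c (z - x - w)) volume := fun w =>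
    (by fun_prop : Continuous fun x => c (z - x - w)).aestronglyMeasurable
  have hs := fun w => integrable_mul_of_eLpNorm_two (hWm w) (hW w) f
  refine (integrable_prod_iff hm).2 ⟨Filter.Eventually.of_forall fun w => ?_, ?_⟩
  · refine (((hs w).1).const_mul (a w)).congr (Filter.Eventually.of_forall fun x => ?_)
    simp only [Function.uncurry]
    ring
  · refine Integrable.mono' (hai.norm.mul_const ((eLpNorm c 2 volume).toNNReal * ‖f‖))
      hm.norm.integral_prod_right' (Filter.Eventually.of_forall fun w => ?_)
    rw [Real.norm_of_nonneg (integral_nonneg fun x => norm_nonneg _)]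
    have e : ∀ x, ‖Function.uncurry (fun w x => a w * (f x * c (z - x - w))) (w, x)‖
        = ‖a w‖ * ‖c (z - x - w) * f x‖ := fun x => by
      simp only [Function.uncurry, norm_mul]
      ring
    simp_rw [e]
    rw [integral_const_mul]
    exact mul_le_mul_of_nonneg_left (hs w).2 (norm_nonneg _)

/-- Mollification by a bump of mass one gives a continuous bounded function. By Fubini its Gaussian
averages are bump averages of those of `f`, hence at most `B`, and so are its values. Lebesgue
differentiation along shrinking bumps returns to `f`. -/
theorem eLpNorm_top_le_of_forall_norm_integral_packet_le {n : ℕ}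
    (f : Lp ℂ 2 (volume : Measure (RSpace n))) {B : ℝ}
    (hB : ∀ ε : ℝ, 0 < ε → ∀ y, ‖∫ x, f x * packet ε y 0 0 x‖ ≤ B) :
    eLpNorm f ∞ volume ≤ ENNReal.ofReal B := by
  rw [eLpNorm_exponent_top]
  refine eLpNormEssSup_le_of_ae_bound ?_
  have hf : LocallyIntegrable f volume := (Lp.memLp f).locallyIntegrable one_le_two
  let φ : ℕ → ContDiffBump (0 : RSpace n) := fun k =>
    ⟨1 / (k + 1), 2 / (k + 1), by positivity, by gcongr; norm_num⟩
  have hφ1 : Filter.Tendsto (fun k => (φ k).rOut) Filter.atTop (nhds 0) := by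
    have := (tendsto_one_div_add_atTop_nhds_zero_nat (𝕜 := ℝ)).const_mul 2
    rw [mul_zero] at this
    refine this.congr fun k => ?_
    change _ = (2 : ℝ) / (k + 1)
    ring
  have hφ2 : ∀ᶠ k in Filter.atTop, (φ k).rOut ≤ 2 * (φ k).rIn :=
    Filter.Eventually.of_forall fun k => by
      change (2 : ℝ) / (k + 1) ≤ 2 * (1 / (k + 1))
      exact le_of_eq (by ring)
  filter_upwards [ContDiffBump.ae_convolution_tendsto_right_of_locallyIntegrable hφ1 hφ2 hf]
    with z hz
  refine le_of_tendsto hz.norm (Filter.Eventually.of_forall fun k => ?_)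
  set η : RSpace n → ℝ := (φ k).normed volume with hη
  have hηc : Continuous η := (φ k).continuous_normed
  have hηs : HasCompactSupport η := (φ k).hasCompactSupport_normed
  have hηi : Integrable η volume := hηc.integrable_of_hasCompactSupport hηs
  set b : RSpace n → ℂ := fun x => (η x : ℂ) with hb
  have hbc : Continuous b := Complex.continuous_ofReal.comp hηc
  have hbs : HasCompactSupport b := hηs.comp_left Complex.ofReal_zero
  have hbi : Integrable b volume := hbc.integrable_of_hasCompactSupport hbs
  have hb2 : MemLp b 2 volume := hbc.memLp_of_hasCompactSupport hbs
  set c : RSpace n → ℂ := fun w => ∫ x, f x * b (z - x - w) with hc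
  have hconv : ∀ w, convolution η f (ContinuousLinearMap.lsmul ℝ ℝ) volume (z - w) = c w := by
    intro w
    rw [convolution_eq_swap]
    refine integral_congr_ae (Filter.Eventually.of_forall fun x => ?_)
    simp only [hb, ContinuousLinearMap.lsmul_apply, Complex.real_smul]
    rw [mul_comm, sub_right_comm]
  have hcc : Continuous c := by
    have h1 := hηs.continuous_convolution_left (ContinuousLinearMap.lsmul ℝ ℝ) hηc hf
    have h2 : Continuous fun w : RSpace n => z - w := by fun_prop
    exact (h1.comp h2).congr hconv
  have hcK : ∀ w, ‖c w‖ ≤ (eLpNorm b 2 volume).toNNReal * ‖f‖ := by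
    intro w
    have hW : eLpNorm (fun x => b (z - x - w)) 2 volume ≤ (eLpNorm b 2 volume).toNNReal :=
      (eLpNorm_reflect hb2 z w).trans_le (ENNReal.coe_toNNReal hb2.2.ne).ge
    have hWm : Continuous fun x => b (z - x - w) := by fun_prop
    refine (norm_integral_le_integral_norm _).trans (le_trans (le_of_eq ?_)
      (integrable_mul_of_eLpNorm_two hWm.aestronglyMeasurable hW f).2)
    simp_rw [mul_comm]
  have hfin : ‖c 0‖ ≤ B := by
    refine norm_le_of_forall_norm_integral_packet_le hcc hcK fun R hR => ?_
    set ε : ℝ := R ^ 2 with hε_def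
    have hε : 0 < ε := by positivity
    have hp1 := memLp_one_iff_integrable.1 (memLp_packet hε (0 : RSpace n) 0 0 1)
    have hpc := continuous_packet hε (0 : RSpace n) 0 0
    have e1 : ∫ w, packet ε 0 0 0 w * c w
        = ∫ v, b v * ∫ x, f x * packet ε (z - v) 0 0 x := by
      calc _ = ∫ w, ∫ x, packet ε 0 0 0 w * (f x * b (z - x - w)) := by
            simp_rw [hc, integral_const_mul]
        _ = ∫ x, ∫ w, packet ε 0 0 0 w * (f x * b (z - x - w)) :=
            integral_integral_swap (integrable_prod_mul_shift hpc hp1 hbc hb2 f z)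
        _ = ∫ x, ∫ v, b v * (f x * packet ε 0 0 0 (z - x - v)) := by
            refine integral_congr_ae (Filter.Eventually.of_forall fun x => ?_)
            simp only
            rw [← integral_sub_left_eq_self _ volume (z - x)]
            refine integral_congr_ae (Filter.Eventually.of_forall fun v => ?_)
            simp only [sub_sub_cancel]
            ring
        _ = ∫ v, ∫ x, b v * (f x * packet ε 0 0 0 (z - x - v)) :=
            (integral_integral_swap (integrable_prod_mul_shift hbc hbi hpc
              (memLp_packet hε 0 0 0 2) f z)).symm
        _ = _ := by
            refine integral_congr_ae (Filter.Eventually.of_forall fun v => ?_)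
            simp only
            rw [← integral_const_mul]
            refine integral_congr_ae (Filter.Eventually.of_forall fun x => ?_)
            simp only
            rw [packet_zero hε, packet_zero hε, sub_zero, ← norm_neg (z - x - v),
              show -(z - x - v) = x - (z - v) by abel]
    rw [e1]
    refine (norm_integral_le_of_norm_le (hηi.mul_const B)
      (Filter.Eventually.of_forall fun v => ?_)).trans_eq ?_
    · rw [norm_mul, hb, Complex.norm_real, Real.norm_of_nonneg ((φ k).nonneg_normed v)]
      exact mul_le_mul_of_nonneg_left (hB ε hε _) ((φ k).nonneg_normed v)
    · rw [integral_mul_const, hη, (φ k).integral_normed, one_mul]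
  rw [← hconv, sub_zero] at hfin
  exact hfin

/-! ### The time integral of two decaying factors -/

theorem intervalIntegral_rpow_neg_le {α u v : ℝ} (hα : 1 < α) (hu : 0 < u) (huv : u ≤ v) :
    ∫ r in u..v, r ^ (-α) ≤ u ^ (1 - α) / (α - 1) := by
  have hmem : (0 : ℝ) ∉ Set.uIcc u v := by
    rw [Set.uIcc_of_le huv]
    exact fun h => hu.not_ge h.1
  rw [integral_rpow (Or.inr ⟨by linarith, hmem⟩), show -α + 1 = -(α - 1) by ring,
    div_neg, ← neg_div, neg_sub, show (1 : ℝ) - α = -(α - 1) by ring]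
  have : 0 ≤ v ^ (-(α - 1)) := Real.rpow_nonneg (hu.le.trans huv) _
  have h1 : 0 < α - 1 := by linarith
  gcongr
  linarith

theorem one_add_abs_div_two_le_bracket (r : ℝ) : (1 + |r|) / 2 ≤ bracket r := by
  refine Real.le_sqrt_of_sq_le ?_
  nlinarith [sq_nonneg (1 - |r|), sq_abs r]

theorem bracket_pos (r : ℝ) : 0 < bracket r := Real.sqrt_pos.2 (by positivity)

theorem continuous_decay_product {α δ : ℝ} (hδ : 0 < δ) (t : ℝ) :
    Continuous fun r : ℝ => max |t - r| δ ^ (-α) * bracket r ^ (-α) := by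
  have h1 : Continuous fun r : ℝ => max |t - r| δ := by fun_prop
  have h2 : Continuous bracket := by unfold bracket; fun_prop
  exact (h1.rpow_const fun r => Or.inl (hδ.trans_le (le_max_right _ _)).ne').mul
    (h2.rpow_const fun r => Or.inl (bracket_pos r).ne')

/-- Either `r` or `t - r` is at least `t / 2`: that factor yields `(t / 2)^{-α}`, and the other is
integrable because `α > 1` and `t - r ≥ δ`. -/
theorem integral_decay_product_le {α δ t a : ℝ} (hα : 1 < α) (hδ : 0 < δ) (ht : 0 < t)
    (ha : 0 ≤ a) (hat : a + δ ≤ t) :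
    ∫ r in (0 : ℝ)..a, max |t - r| δ ^ (-α) * bracket r ^ (-α)
      ≤ 2 ^ α * (δ ^ (1 - α) / (α - 1) + 2 ^ α / (α - 1)) * t ^ (-α) := by
  have hα1 : 0 < α - 1 := by linarith
  have cont1 : ContinuousOn (fun r : ℝ => (t - r) ^ (-α)) (Set.uIcc 0 a) := by
    rw [Set.uIcc_of_le ha]
    exact ContinuousOn.rpow_const (by fun_prop) fun r hr => Or.inl (by linarith [hr.2])
  have cont2 : ContinuousOn (fun r : ℝ => (1 + r) ^ (-α)) (Set.uIcc 0 a) := by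
    rw [Set.uIcc_of_le ha]
    exact ContinuousOn.rpow_const (by fun_prop) fun r hr => Or.inl (by linarith [hr.1])
  have hpt : ∀ r ∈ Set.Icc 0 a, max |t - r| δ ^ (-α) * bracket r ^ (-α)
      ≤ (t / 2) ^ (-α) * ((t - r) ^ (-α) + 2 ^ α * (1 + r) ^ (-α)) := by
    intro r hr
    have hr1 : δ ≤ t - r := by linarith [hr.2]
    have hr0 : 0 < t - r := by linarith
    have hr2 : 0 < 1 + r := by linarith [hr.1]
    rw [abs_of_pos hr0, max_eq_left hr1]
    have hb := one_add_abs_div_two_le_bracket r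
    rw [abs_of_nonneg hr.1] at hb
    have hb1 : bracket r ^ (-α) ≤ 2 ^ α * (1 + r) ^ (-α) := by
      refine (Real.rpow_le_rpow_of_nonpos (by linarith) hb (by linarith)).trans_eq ?_
      rw [Real.div_rpow hr2.le zero_le_two, Real.rpow_neg zero_le_two, div_inv_eq_mul, mul_comm]
    have hA : 0 ≤ (t - r) ^ (-α) := Real.rpow_nonneg hr0.le _
    have hB : 0 ≤ bracket r ^ (-α) := Real.rpow_nonneg (bracket_pos r).le _
    have hT : 0 ≤ (t / 2) ^ (-α) := by positivity
    rcases le_total (t / 2) r with h | h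
    · have : bracket r ^ (-α) ≤ (t / 2) ^ (-α) := by
        refine Real.rpow_le_rpow_of_nonpos (by linarith) (h.trans ?_) (by linarith)
        refine Real.le_sqrt_of_sq_le ?_
        linarith
      calc _ ≤ (t - r) ^ (-α) * (t / 2) ^ (-α) := by gcongr
        _ = (t / 2) ^ (-α) * ((t - r) ^ (-α) + 0) := by ring
        _ ≤ _ := by gcongr; positivity
    · have : (t - r) ^ (-α) ≤ (t / 2) ^ (-α) :=
        Real.rpow_le_rpow_of_nonpos (by linarith) (by linarith) (by linarith)
      calc _ ≤ (t / 2) ^ (-α) * bracket r ^ (-α) := by gcongr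
        _ ≤ (t / 2) ^ (-α) * (0 + 2 ^ α * (1 + r) ^ (-α)) := by rw [zero_add]; gcongr
        _ ≤ _ := by gcongr
  have hint1 : ∫ r in (0 : ℝ)..a, (t - r) ^ (-α) ≤ δ ^ (1 - α) / (α - 1) := by
    rw [intervalIntegral.integral_comp_sub_left (fun r => r ^ (-α)) t, sub_zero]
    refine (intervalIntegral_rpow_neg_le hα (by linarith) (by linarith)).trans ?_
    exact div_le_div_of_nonneg_right
      (Real.rpow_le_rpow_of_nonpos hδ (by linarith) (by linarith)) hα1.le
  have hint2 : ∫ r in (0 : ℝ)..a, (1 + r) ^ (-α) ≤ 1 / (α - 1) := by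
    rw [intervalIntegral.integral_comp_add_left (fun r => r ^ (-α)) 1, add_zero]
    refine (intervalIntegral_rpow_neg_le hα one_pos (by linarith)).trans ?_
    rw [Real.one_rpow]
  calc _ ≤ ∫ r in (0 : ℝ)..a, (t / 2) ^ (-α) * ((t - r) ^ (-α) + 2 ^ α * (1 + r) ^ (-α)) :=
        intervalIntegral.integral_mono_on ha
          ((continuous_decay_product hδ t).intervalIntegrable _ _)
          ((cont1.add (cont2.const_mul _)).const_mul _).intervalIntegrable hpt
    _ = (t / 2) ^ (-α) * ((∫ r in (0 : ℝ)..a, (t - r) ^ (-α))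
          + 2 ^ α * ∫ r in (0 : ℝ)..a, (1 + r) ^ (-α)) := by
        rw [intervalIntegral.integral_const_mul, intervalIntegral.integral_add
          cont1.intervalIntegrable (cont2.const_mul _).intervalIntegrable,
          intervalIntegral.integral_const_mul]
    _ ≤ (t / 2) ^ (-α) * (δ ^ (1 - α) / (α - 1) + 2 ^ α * (1 / (α - 1))) := by gcongr
    _ = _ := by
        rw [Real.div_rpow ht.le zero_le_two, Real.rpow_neg zero_le_two, div_inv_eq_mul]
        ring

theorem abs_integral_decay_product_le {α δ t a : ℝ} (hα : 1 < α) (hδ : 0 < δ) (ht : t ≠ 0)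
    (ha : a ∈ Set.uIcc 0 t) (hat : δ ≤ |t - a|) :
    |∫ r in (0 : ℝ)..a, max |t - r| δ ^ (-α) * bracket r ^ (-α)|
      ≤ 2 ^ α * (δ ^ (1 - α) / (α - 1) + 2 ^ α / (α - 1)) * |t| ^ (-α) := by
  have hnn : ∀ s r : ℝ, 0 ≤ max |s - r| δ ^ (-α) * bracket r ^ (-α) := fun s r =>
    mul_nonneg (Real.rpow_nonneg ((abs_nonneg _).trans (le_max_left _ _)) _)
      (Real.rpow_nonneg (bracket_pos r).le _)
  rcases ht.lt_or_gt with ht | ht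
  · rw [Set.uIcc_of_ge ht.le] at ha
    have e : ∫ r in (0 : ℝ)..a, max |t - r| δ ^ (-α) * bracket r ^ (-α)
        = -∫ r in (0 : ℝ)..(-a), max |(-t) - r| δ ^ (-α) * bracket r ^ (-α) := by
      rw [← intervalIntegral.integral_symm, ← neg_zero, ← intervalIntegral.integral_comp_neg,
        neg_zero]
      refine intervalIntegral.integral_congr fun r _ => ?_
      simp only [bracket, neg_sq]
      rw [show -t - -r = -(t - r) by ring, abs_neg]
    rw [abs_of_nonpos (by linarith [ha.1])] at hat
    rw [e, abs_neg, abs_of_nonneg (intervalIntegral.integral_nonneg (by linarith [ha.2])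
      fun r _ => hnn _ r), abs_of_neg ht]
    exact integral_decay_product_le hα hδ (by linarith) (by linarith [ha.2])
      (by linarith [ha.1])
  · rw [Set.uIcc_of_le ht.le] at ha
    rw [abs_of_nonneg (by linarith [ha.2])] at hat
    rw [abs_of_nonneg (intervalIntegral.integral_nonneg ha.1 fun r _ => hnn _ r), abs_of_pos ht]
    exact integral_decay_product_le hα hδ ht ha.1 (by linarith)

/-! ### The dispersive bound -/

theorem norm_integral_mul_packet_le {n : ℕ} {F : RSpace n → ℂ} (hF : Integrable F volume) {ε : ℝ}
    (hε : 0 < ε) (y ξ : RSpace n) {τ : ℝ} (hτ : τ ≠ 0) :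
    ‖∫ x, F x * packet ε y ξ τ x‖
      ≤ (eLpNorm F 1 volume).toReal * |τ| ^ (-(n : ℝ) / 2) := by
  rw [eLpNorm_one_eq_lintegral_enorm, ← integral_norm_eq_lintegral_enorm hF.1,
    ← integral_mul_const]
  refine norm_integral_le_of_norm_le (hF.norm.mul_const _)
    (Filter.Eventually.of_forall fun x => ?_)
  rw [norm_mul]
  exact mul_le_mul_of_nonneg_left (norm_packet_le hε y ξ hτ x) (norm_nonneg _)

/-- The splitting time: at distance `δ` before `t`, or 0 when `|t| ≤ δ` and there is no far region.
-/
theorem exists_mem_uIcc_near (t : ℝ) {δ : ℝ} (hδ : 0 ≤ δ) :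
    ∃ a ∈ Set.uIcc 0 t, |t - a| ≤ δ ∧ (a = 0 ∨ ∀ r ∈ Set.uIcc 0 a, δ ≤ |t - r|) := by
  by_cases h : |t| ≤ δ
  · exact ⟨0, Set.left_mem_uIcc, by simpa using h, Or.inl rfl⟩
  push Not at h
  rcases le_total 0 t with ht | ht
  · rw [abs_of_nonneg ht] at h
    refine ⟨t - δ, ?_, by simp [abs_of_nonneg hδ], Or.inr fun r hr => ?_⟩
    · rw [Set.uIcc_of_le ht]
      constructor <;> linarith
    · rw [Set.uIcc_of_le (by linarith)] at hr
      exact le_trans (by linarith [hr.2]) (le_abs_self _)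
  · rw [abs_of_nonpos ht] at h
    refine ⟨t + δ, ?_, by simp [abs_of_nonneg hδ], Or.inr fun r hr => ?_⟩
    · rw [Set.uIcc_of_ge ht]
      constructor <;> linarith
    · rw [Set.uIcc_of_ge (by linarith)] at hr
      exact le_trans (by linarith [hr.1]) (neg_le_abs _)

namespace IsSchrodingerSolution

variable {n : ℕ} {I : Set ℝ} {V : ℝ → RSpace n → ℂ}
  {ψ₀ : Lp ℂ 2 (volume : Measure (RSpace n))} {ψ : ℝ → Lp ℂ 2 (volume : Measure (RSpace n))}

theorem integrable_potential_mul {M₁ : ℝ≥0}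
    (hVm : ∀ t ∈ I, AEStronglyMeasurable (V t) volume) (hV : ∀ t ∈ I, normInter (V t) ≤ M₁)
    {r : ℝ} (hr : r ∈ I) : Integrable (fun x => V r x * ψ r x) volume :=
  (integrable_mul_of_eLpNorm_two (hVm r hr) ((le_max_right _ _).trans (hV r hr)) (ψ r)).1

/-- The wave packet coefficients at a time separated from `t` are controlled by the decay of the
solution in the sum space. -/
theorem norm_integral_packet_le_of_decay (hψ : IsSchrodingerSolution I V ψ₀ ψ)
    (hI : I.OrdConnected) (h0 : (0 : ℝ) ∈ I) (hn : 3 ≤ n) {M₁ A : ℝ≥0}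
    (hVm : ∀ t ∈ I, AEStronglyMeasurable (V t) volume) (hV : ∀ t ∈ I, normInter (V t) ≤ M₁)
    (hψ₀ : MemLp ψ₀ 1 volume)
    (hdecay : ∀ t ∈ I, normSum (ψ t) ≤
      A * ENNReal.ofReal (bracket t ^ (-(n : ℝ) / 2)) * normInter ψ₀)
    {δ : ℝ} (hδ : 0 < δ) {t a : ℝ} (ht : t ≠ 0) (htI : t ∈ I) (ha : a ∈ Set.uIcc 0 t)
    (hat : a = 0 ∨ ∀ r ∈ Set.uIcc 0 a, δ ≤ |t - r|) {ε : ℝ} (hε : 0 < ε) (y ξ : RSpace n) :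
    ‖∫ x, ψ a x * packet ε y ξ (t - a) x‖
      ≤ (1 + M₁ * A * (2 ^ ((n : ℝ) / 2) * (δ ^ (1 - (n : ℝ) / 2) / ((n : ℝ) / 2 - 1)
          + 2 ^ ((n : ℝ) / 2) / ((n : ℝ) / 2 - 1))))
        * (|t| ^ (-(n : ℝ) / 2) * (normInter ψ₀).toReal) := by
  have hn' : (3 : ℝ) ≤ n := by exact_mod_cast hn
  have hα : (1 : ℝ) < n / 2 := by linarith
  have hα1 : (0 : ℝ) < n / 2 - 1 := by linarith
  have hN : normInter ψ₀ ≠ ∞ := (max_lt hψ₀.2 (Lp.eLpNorm_lt_top ψ₀)).ne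
  set N : ℝ := (normInter ψ₀).toReal with hN_def
  have hN0 : 0 ≤ N := ENNReal.toReal_nonneg
  set D : ℝ := 2 ^ ((n : ℝ) / 2) * (δ ^ (1 - (n : ℝ) / 2) / ((n : ℝ) / 2 - 1)
          + 2 ^ ((n : ℝ) / 2) / ((n : ℝ) / 2 - 1)) with hD
  have hD0 : 0 ≤ D := by positivity
  have hinit : ‖∫ x, ψ 0 x * packet ε y ξ (t - 0) x‖ ≤ |t| ^ (-(n : ℝ) / 2) * N := by
    rw [sub_zero, hψ.initial]
    refine (norm_integral_mul_packet_le (memLp_one_iff_integrable.1 hψ₀) hε y ξ ht).trans ?_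
    rw [mul_comm]
    gcongr
    exact ENNReal.toReal_mono hN (le_max_left _ _)
  rcases hat with rfl | hat
  · refine hinit.trans (le_mul_of_one_le_left (by positivity) ?_)
    exact le_add_of_nonneg_right (by positivity)
  have haI : a ∈ I := hI.uIcc_subset h0 htI ha
  -- The maximum with `δ` only makes the majorant continuous on the whole line; on the interval from
  -- 0 to `a` it is inactive.
  have hb := (continuous_decay_product (α := (n : ℝ) / 2) hδ t).const_mul (M₁ * A * N)
  have hVb : ∀ r ∈ Set.uIcc 0 a, ‖∫ x, V r x * ψ r x * packet ε y ξ (t - r) x‖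
      ≤ M₁ * A * N * (max |t - r| δ ^ (-((n : ℝ) / 2)) * bracket r ^ (-((n : ℝ) / 2))) := by
    intro r hr
    have hrI : r ∈ I := hI.uIcc_subset h0 haI hr
    have htr := hat r hr
    have htr0 : t - r ≠ 0 := abs_pos.1 (hδ.trans_le htr)
    refine (norm_integral_mul_packet_le (integrable_potential_mul hVm hV hrI) hε y ξ htr0).trans ?_
    have h1 : eLpNorm (fun x => V r x * ψ r x) 1 volume ≤
        M₁ * (A * ENNReal.ofReal (bracket r ^ (-(n : ℝ) / 2)) * normInter ψ₀) :=
      (eLpNorm_mul_le_normInter_mul_normSum (hVm r hrI) (hV r hrI)).trans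
        (mul_le_mul_right (hdecay r hrI) _)
    have h2 := ENNReal.toReal_mono (ENNReal.mul_ne_top ENNReal.coe_ne_top
      (ENNReal.mul_ne_top (ENNReal.mul_ne_top ENNReal.coe_ne_top ENNReal.ofReal_ne_top) hN)) h1
    rw [ENNReal.toReal_mul, ENNReal.toReal_mul, ENNReal.toReal_mul, ENNReal.coe_toReal,
      ENNReal.coe_toReal, ENNReal.toReal_ofReal (Real.rpow_nonneg (bracket_pos r).le _)] at h2
    rw [max_eq_left htr, ← neg_div]
    calc _ ≤ M₁ * (A * bracket r ^ (-(n : ℝ) / 2) * N) * |t - r| ^ (-(n : ℝ) / 2) := by gcongr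
      _ = _ := by ring
  have h3 := hψ.norm_integral_packet_sub_le hI h0 hVm
    (fun t ht => (le_max_right _ _).trans (hV t ht)) hε y ξ t h0 haI hb hVb
  rw [intervalIntegral.integral_const_mul, abs_mul, abs_of_nonneg (by positivity)] at h3
  have h4 := abs_integral_decay_product_le hα hδ ht ha (hat a Set.right_mem_uIcc)
  rw [← neg_div, ← hD] at h4
  rw [← neg_div] at h3
  have h5 := norm_le_norm_add_norm_sub' (∫ x, ψ a x * packet ε y ξ (t - a) x)
    (∫ x, ψ 0 x * packet ε y ξ (t - 0) x)
  calc _ ≤ |t| ^ (-(n : ℝ) / 2) * N + M₁ * A * N * (D * |t| ^ (-(n : ℝ) / 2)) :=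
        h5.trans (add_le_add hinit (h3.trans (by gcongr)))
    _ = _ := by ring

/-- On a short time interval the supremum of all wave packet coefficients at most doubles. -/
theorem norm_integral_packet_le_two_mul (hψ : IsSchrodingerSolution I V ψ₀ ψ)
    (hI : I.OrdConnected) (h0 : (0 : ℝ) ∈ I) {M₁ M₂ : ℝ≥0}
    (hVm : ∀ t ∈ I, AEStronglyMeasurable (V t) volume) (hV : ∀ t ∈ I, normInter (V t) ≤ M₁)
    (hV' : ∀ t ∈ I, eLpNorm (𝓕 (V t)) 1 volume ≤ M₂) {t a : ℝ} (htI : t ∈ I) (haI : a ∈ I)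
    (hat : M₂ * |t - a| ≤ 1 / 2) {ε R : ℝ} (hε : 0 < ε)
    (hR : ∀ y ξ, ‖∫ x, ψ a x * packet ε y ξ (t - a) x‖ ≤ R) (y ξ : RSpace n) :
    ‖∫ x, ψ t x * packet ε y ξ (t - t) x‖ ≤ 2 * R := by
  have hsub : Set.uIcc a t ⊆ I := hI.uIcc_subset haI htI
  set S : Set ℝ := {v | ∃ s ∈ Set.uIcc a t, ∃ y ξ, v = ‖∫ x, ψ s x * packet ε y ξ (t - s) x‖}
    with hS
  have hne : S.Nonempty := ⟨_, t, Set.right_mem_uIcc, y, ξ, rfl⟩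
  -- Finiteness of the supremum is needed for the absorption below; this `ε`-dependent bound does
  -- not enter the result.
  have hbdd : BddAbove S := by
    obtain ⟨B, hB⟩ := exists_eLpNorm_packet_le (n := n) hε |t - a|
    obtain ⟨N, hN⟩ := isCompact_uIcc.exists_bound_of_continuousOn (hψ.continuousOn.mono hsub)
    refine ⟨B * N, ?_⟩
    rintro v ⟨s, hs, y, ξ, rfl⟩
    have hτ : |t - s| ≤ |t - a| := by
      rw [Set.uIcc_comm] at hs
      simpa [abs_sub_comm] using Set.abs_sub_left_of_mem_uIcc hs
    have h1 := (integrable_mul_of_eLpNorm_two (continuous_packet hε y ξ _).aestronglyMeasurable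
      (hB y ξ _ hτ) (ψ s)).2
    simp_rw [mul_comm (packet _ _ _ _ _)] at h1
    exact (norm_integral_le_integral_norm _).trans
      (h1.trans (mul_le_mul_of_nonneg_left (hN s hs) B.2))
  set K : ℝ := sSup S with hK
  have hle : ∀ s ∈ Set.uIcc a t, ∀ y ξ, ‖∫ x, ψ s x * packet ε y ξ (t - s) x‖ ≤ K :=
    fun s hs y ξ => le_csSup hbdd ⟨s, hs, y, ξ, rfl⟩
  have hK0 : 0 ≤ K := (norm_nonneg _).trans (hle t Set.right_mem_uIcc y ξ)
  have hVb : ∀ y ξ : RSpace n, ∀ r ∈ Set.uIcc a t,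
      ‖∫ x, V r x * ψ r x * packet ε y ξ (t - r) x‖ ≤ M₂ * K := by
    intro y ξ r hr
    have hVi : Integrable (V r) volume := memLp_one_iff_integrable.1
      ⟨hVm r (hsub hr), ((le_max_left _ _).trans (hV r (hsub hr))).trans_lt ENNReal.coe_lt_top⟩
    have hF : Integrable (fun x => ψ r x * packet ε y ξ (t - r) x) volume :=
      (Lp.memLp (ψ r)).integrable_mul (memLp_packet hε y ξ (t - r) 2)
    simp_rw [mul_assoc]
    -- Each character turns the packet into another packet times a unit phase, so the twisted
    -- integral is again bounded by `K`. This is why the supremum runs over all `y` and `ξ`.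
    refine norm_integral_mul_le_of_eLpNorm_fourier_le hVi (hV' r (hsub hr)) hF fun ζ => ?_
    obtain ⟨ω, hω, hωp⟩ := exists_character_mul_packet hε y ξ ζ (t - r)
    simp_rw [mul_left_comm _ (ψ r _), hωp, mul_left_comm _ ω]
    rw [integral_const_mul, norm_mul, hω, one_mul]
    exact hle r hr _ _
  have hall : ∀ s ∈ Set.uIcc a t, ∀ y ξ,
      ‖∫ x, ψ s x * packet ε y ξ (t - s) x‖ ≤ R + 1 / 2 * K := by
    intro s hs y ξ
    have hs' : Set.uIcc a s ⊆ Set.uIcc a t := Set.uIcc_subset_uIcc_left hs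
    have h3 := hψ.norm_integral_packet_sub_le hI h0 hVm
      (fun t ht => (le_max_right _ _).trans (hV t ht)) hε y ξ t haI (hsub hs)
      (b := fun _ => M₂ * K) continuous_const (fun r hr => hVb y ξ r (hs' hr))
    rw [intervalIntegral.integral_const, smul_eq_mul, abs_mul,
      abs_of_nonneg (mul_nonneg M₂.coe_nonneg hK0)] at h3
    have h4 : |s - a| ≤ |t - a| := Set.abs_sub_left_of_mem_uIcc hs
    have h5 := norm_le_norm_add_norm_sub' (∫ x, ψ s x * packet ε y ξ (t - s) x)
      (∫ x, ψ a x * packet ε y ξ (t - a) x)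
    refine h5.trans (add_le_add (hR y ξ) (h3.trans ?_))
    calc |s - a| * (M₂ * K) ≤ |t - a| * (M₂ * K) := by gcongr
      _ = M₂ * |t - a| * K := by ring
      _ ≤ 1 / 2 * K := by gcongr
  have hKR : K ≤ R + 1 / 2 * K := by
    refine csSup_le hne ?_
    rintro v ⟨s, hs, y, ξ, rfl⟩
    exact hall s hs y ξ
  exact (hle t Set.right_mem_uIcc y ξ).trans (by linarith)

end IsSchrodingerSolution

theorem proposition4p1 (n : ℕ) (hn : 3 ≤ n) (M₁ M₂ A : ℝ≥0) :
    ∃ C : ℝ≥0, ∀ (I : Set ℝ), I.OrdConnected → (0 : ℝ) ∈ I →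
      ∀ V : ℝ → RSpace n → ℂ,
        AEStronglyMeasurable (Function.uncurry V) ((volume.restrict I).prod volume) →
        (∀ t ∈ I, AEStronglyMeasurable (V t) volume) →
        (∀ t ∈ I, normInter (V t) ≤ M₁) →
        (∀ t ∈ I, eLpNorm (𝓕 (V t)) 1 volume ≤ M₂) →
      ∀ (ψ₀ : Lp ℂ 2 (volume : Measure (RSpace n)))
        (ψ : ℝ → Lp ℂ 2 (volume : Measure (RSpace n))),
        MemLp ψ₀ 1 volume →
        IsSchrodingerSolution I V ψ₀ ψ →
        (∀ t ∈ I, normSum (ψ t) ≤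
          A * ENNReal.ofReal (bracket t ^ (-(n : ℝ) / 2)) * normInter ψ₀) →
        ∀ t ∈ I, t ≠ 0 →
          eLpNorm (ψ t) ∞ volume ≤ C * ENNReal.ofReal (|t| ^ (-(n : ℝ) / 2)) * normInter ψ₀ := by
  -- Chosen so that `M₂ δ ≤ 1/2`; the added 1 covers `M₂ = 0`.
  set δ : ℝ := 1 / (2 * (M₂ + 1)) with hδ_def
  have hδ : 0 < δ := by positivity
  have hMδ : M₂ * δ ≤ 1 / 2 := by
    rw [hδ_def, mul_one_div, div_le_div_iff₀ (by positivity) two_pos]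
    linarith [M₂.2]
  have hα1 : (0 : ℝ) < n / 2 - 1 := by
    have : (3 : ℝ) ≤ n := by exact_mod_cast hn
    linarith
  -- The 2 comes from the absorption near `t`, the 1 from the initial datum and the rest from the
  -- potential away from `t`.
  set C : ℝ := 2 * (1 + M₁ * A * (2 ^ ((n : ℝ) / 2) * (δ ^ (1 - (n : ℝ) / 2) / ((n : ℝ) / 2 - 1)
    + 2 ^ ((n : ℝ) / 2) / ((n : ℝ) / 2 - 1)))) with hC
  have hC0 : 0 ≤ C := by positivity
  refine ⟨⟨C, hC0⟩, fun I hI h0 V _ hVm hV hV' ψ₀ ψ hψ₀ hψ hdecay t htI ht => ?_⟩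
  obtain ⟨a, ha, hta, hat⟩ := exists_mem_uIcc_near t hδ.le
  have hN : normInter ψ₀ ≠ ∞ := (max_lt hψ₀.2 (Lp.eLpNorm_lt_top ψ₀)).ne
  have hB : eLpNorm (ψ t) ∞ volume
      ≤ ENNReal.ofReal (C * |t| ^ (-(n : ℝ) / 2) * (normInter ψ₀).toReal) := by
    refine eLpNorm_top_le_of_forall_norm_integral_packet_le (ψ t) fun ε hε y => ?_
    have h1 := hψ.norm_integral_packet_le_two_mul hI h0 hVm hV hV' htI
      (hI.uIcc_subset h0 htI ha) ((mul_le_mul_of_nonneg_left hta M₂.2).trans hMδ) hε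
      (hψ.norm_integral_packet_le_of_decay hI h0 hn hVm hV hψ₀ hdecay hδ ht htI ha hat hε) y 0
    rw [sub_self] at h1
    refine h1.trans_eq ?_
    rw [hC]
    ring
  refine hB.trans_eq ?_
  rw [ENNReal.ofReal_mul (by positivity), ENNReal.ofReal_mul hC0, ENNReal.ofReal_toReal hN]
  congr 2
  exact ENNReal.ofReal_eq_coe_nnreal hC0
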